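/- Let $d\ge 2$ be finite or countably infinite, let $\mathcal H$ be a complex Hilbert space and let $\underline A=(A_1,\dots,A_d)$, $A_i\in B(\mathcal H)$, be coisometric, $\sum_i A_iA_i^*=\mathbf 1$ (strongly), and ergodic, i.e. the only $X\in B(\mathcal H)$ with $\sum_i A_iXA_i^*=X$ are the multiples of $\mathbf 1$. Let $\Omega\in\mathcal H$ be a unit vector and $\underline\omega\in\mathbb C^d$, $\sum_i|\omega_i|^2=1$, with $A_i^*\Omega=\bar\omega_i\Omega$ for all $i$. Notation. For a row contraction $\underline T=(T_1,\dots,T_d)$ on a Hilbert space $\mathcal K$, regarded as an operator $\bigoplus_{i=1}^d\mathcal K\to\mathcal K$, put $D_T=(\mathbf 1-\underline T^*\underline T)^{1/2}$ and $D_{*,T}=(\mathbf 1-\underline T\,\underline T^*)^{1/2}$, and let $\mathcal D_T\subset\bigoplus_{i=1}^d\mathcal K$ and $\mathcal D_{*,T}\subset\mathcal K$ be the closures of their ranges. For $h\in\mathcal K$ let $h^{(i)}\in\bigoplus_{i=1}^d\mathcal K$ be $h$ placed in the $i$-th component, and let $P_j$ denote the $j$-th component. Let $\Gamma$ be the full Fock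 space over $\mathbb C^d$ (over $\ell^2$ if $d=\infty$), with orthonormal basis $e_\alpha$ indexed by the words $\alpha$ in $1,\dots,d$ ($e_0$ the vacuum, for the empty word), and $T_\alpha=T_{\alpha_1}\cdots T_{\alpha_m}$. Popescu's minimal isometric dilation of $\underline T$ consists of the operators $V^T_i\bigl(h\oplus x\bigr)=T_ih\oplus\bigl(e_0\otimes D_Th^{(i)}+e_i\otimes x\bigr)$ on $\mathcal K\oplus(\Gamma\otimes\mathcal D_T)$. The Poisson kernel and Popescu's characteristic function of $\underline T$ are $$C_T:\mathcal K\to\Gamma\otimes\mathcal D_{*,T},\qquad C_Th=\sum_\alpha e_\alpha\otimes D_{*,T}T_\alpha^*h,$$ $$\theta_T:\mathcal D_T\to\Gamma\otimes\mathcal D_{*,T},\qquad \theta_Tf=-e_0\otimes\sum_jT_jP_jf+\sum_je_j\otimes\sum_\alpha e_\alpha\otimes D_{*,T}T_\alpha^*P_jD_Tf .$$ View $\underline\omega$ as a row contraction on $\mathbb C$, so that $\mathcal D_\omega\subset\mathbb C^d$ (with standard basis $\epsilon_i$). Let $\mathring{\mathcal H}=\mathcal H\ominus\mathbb C\Omega$,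 let $\mathring{\underline A}$ be the compression of $\underline A$ to $\mathring{\mathcal H}$, with $\mathring D=D_{\mathring A}$, $\mathring D_*=D_{*,\mathring A}$, $\mathring C=C_{\mathring A}$, and put $\hat D_*h=\sum_i\langle\Omega,A_i^*h\rangle\,\epsilon_i$ for $h\in\mathring{\mathcal H}$. Claim. The tuple $\mathring{\underline A}$ is $*$-stable, that is, $\sum_{|\alpha|=n}\|\mathring A_\alpha^*h\|^2\to0$ as $n\to\infty$ for every $h\in\mathring{\mathcal H}$. There is exactly one unitary $W:\mathcal H\oplus(\Gamma\otimes\mathcal D_A)\to\mathbb C\oplus(\Gamma\otimes\mathcal D_\omega)$ with $WV_i^A=V_i^\omega W$ for all $i$ and $W\Omega=1\in\mathbb C$. Put $\hat C=W|_{\mathcal H}$ and let $\hat\theta:\mathcal D_A\to\mathbb C\oplus(\Gamma\otimes\mathcal D_\omega)$, $\hat\theta f=W(e_0\otimes f)$, be the extended characteristic function of $\underline A$; its values lie in $\Gamma\otimes\mathcal D_\omega$. There is a linear isometry $\gamma:\mathcal D_{*,\mathring A}\to\mathcal D_\omega$ such that for all $h\in\mathring{\mathcal H}$ and all $i$ $$\gamma\mathring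 D_*h=\hat D_*h,\qquad(\mathbf 1\otimes\gamma)\,\mathring Ch=\hat Ch,\qquad(\mathbf 1\otimes\gamma)\,\theta_{\mathring A}\bigl(\mathring D h^{(i)}\bigr)=\hat\theta\bigl(D_Ah^{(i)}\bigr).$$ -/

import Mathlib

noncomputable section

open ContinuousLinearMap
open scoped ENNReal

/-- `HilbertSum ι E` is the Hilbert space direct sum of copies of `E` indexed by `ι`
(canonically, `ℓ²(ι) ⊗ E`). -/
abbrev HilbertSum (ι : Type*) (E : Type*) [NormedAddCommGroup E] : Type _ :=
  lp (fun _ : ι => E) 2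

/-- The full Fock space `Γ` over `ℓ²(ι)`, tensored with the Hilbert space `E`. The vectors
`e_α`, `α` a word in the alphabet `ι`, form an orthonormal basis of `Γ`, so a vector of `Γ ⊗ E` is
`∑_α e_α ⊗ x_α` with a square summable family `x` of vectors of `E` indexed by words. -/
abbrev FockTensor (ι : Type*) (E : Type*) [NormedAddCommGroup E] : Type _ :=
  HilbertSum (List ι) E

namespace HilbertSum

variable {ι : Type*} {E F : Type*} [NormedAddCommGroup E] [InnerProductSpace ℂ E]
  [NormedAddCommGroup F] [InnerProductSpace ℂ F]

set_option linter.unusedSectionVars false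

open Classical in
/-- The embedding of `E` as the `i`-th summand, `x ↦ e_i ⊗ x`. -/
def incl (i : ι) : E →L[ℂ] HilbertSum ι E :=
  lp.singleContinuousLinearMap ℂ (fun _ : ι => E) 2 i

/-- `1 ⊗ T : ℓ²(ι) ⊗ E → ℓ²(ι) ⊗ F`. -/
def ampliation (T : E →L[ℂ] F) : HilbertSum ι E →L[ℂ] HilbertSum ι F :=
  lp.mapCLM 2 (fun _ : ι => T) (K := ‖T‖) (norm_nonneg _) (fun _ => le_rfl)

lemma ampliation_apply (T : E →L[ℂ] F) (x : HilbertSum ι E) (i : ι) :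
    ampliation T x i = T (x i) := rfl

lemma memlp_of_sum_le {f : ι → E} {C : ℝ} (hf : ∀ s : Finset ι, ∑ i ∈ s, ‖f i‖ ^ 2 ≤ C) :
    Memℓp f 2 :=
  memℓp_gen' (C := C) fun s => by simpa using hf s

lemma norm_sq_eq (x : HilbertSum ι E) : HasSum (fun i => ‖x i‖ ^ 2) (‖x‖ ^ 2) := by
  simpa using lp.hasSum_norm (p := 2) (by norm_num) x

lemma sum_norm_sq_le (x : HilbertSum ι E) (s : Finset ι) : ∑ i ∈ s, ‖x i‖ ^ 2 ≤ ‖x‖ ^ 2 :=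
  sum_le_hasSum s (fun _ _ => by positivity) (norm_sq_eq x)

lemma norm_sq_le {x : HilbertSum ι E} {C : ℝ} (h : ∀ s : Finset ι, ∑ i ∈ s, ‖x i‖ ^ 2 ≤ C) :
    ‖x‖ ^ 2 ≤ C :=
  le_of_tendsto (norm_sq_eq x) (Filter.Eventually.of_forall h)

end HilbertSum

/-- The positive square root of a positive operator on a Hilbert space. -/
def positiveSqrt {E : Type*} [NormedAddCommGroup E] [InnerProductSpace ℂ E] [CompleteSpace E]
    (T : E →L[ℂ] E) : E →L[ℂ] E :=
  CFC.sqrt T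

namespace FockTensor

variable {ι : Type*} {E : Type*} [NormedAddCommGroup E] [InnerProductSpace ℂ E]

lemma sum_word_le {u : List ι → ℝ} {a c : ℝ} {b : ι → ℝ} (hu : ∀ α, 0 ≤ u α)
    (s : Finset (List ι)) (h0 : u [] ≤ a)
    (hb : ∀ i, ∀ t : Finset (List ι), (∀ β ∈ t, i :: β ∈ s) → ∑ β ∈ t, u (i :: β) ≤ b i)
    (hc : ∀ r : Finset ι, ∑ i ∈ r, b i ≤ c) :
    ∑ α ∈ s, u α ≤ a + c := by
  classical
  let r : Finset ι := s.biUnion fun α => α.toFinset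
  let t : ι → Finset (List ι) := fun i =>
    (s.image List.tail).filter fun β => i :: β ∈ s
  have hsub : s ⊆ insert [] (r.biUnion fun i => (t i).image (List.cons i)) := by
    intro α hα
    cases α with
    | nil => simp
    | cons i β =>
      refine Finset.mem_insert_of_mem (Finset.mem_biUnion.2 ⟨i, ?_, ?_⟩)
      · exact Finset.mem_biUnion.2 ⟨i :: β, hα, by simp⟩
      · refine Finset.mem_image.2 ⟨β, Finset.mem_filter.2 ⟨?_, hα⟩, rfl⟩
        exact Finset.mem_image.2 ⟨i :: β, hα, rfl⟩
  calc ∑ α ∈ s, u α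
      ≤ ∑ α ∈ insert [] (r.biUnion fun i => (t i).image (List.cons i)), u α :=
        Finset.sum_le_sum_of_subset_of_nonneg hsub fun _ _ _ => hu _
    _ ≤ u [] + ∑ α ∈ r.biUnion (fun i => (t i).image (List.cons i)), u α := by
        rw [Finset.sum_insert (by simp)]
    _ ≤ u [] + ∑ i ∈ r, ∑ α ∈ (t i).image (List.cons i), u α := by
        rw [Finset.sum_biUnion]
        intro i _ j _ hij
        rw [Function.onFun, Finset.disjoint_left]
        intro α hi hj
        obtain ⟨β, -, rfl⟩ := Finset.mem_image.1 hi
        obtain ⟨β', -, h⟩ := Finset.mem_image.1 hj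
        exact hij (List.cons.inj h).1.symm
    _ ≤ a + ∑ i ∈ r, b i := by
        gcongr with i _
        rw [Finset.sum_image (by simp)]
        exact hb i _ fun β hβ => (Finset.mem_filter.1 hβ).2
    _ ≤ a + c := by gcongr; exact hc r

/-- The coordinates of `(L_i ⊗ 1) x = e_i ⊗ x`. -/
def creationFun [DecidableEq ι] (i : ι) (x : List ι → E) : List ι → E
  | [] => 0
  | j :: α => if j = i then x α else 0

lemma creationFun_sum_le [DecidableEq ι] (i : ι) (x : FockTensor ι E) (s : Finset (List ι)) :
    ∑ α ∈ s, ‖creationFun i x α‖ ^ 2 ≤ ‖x‖ ^ 2 := by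
  have := sum_word_le (u := fun α => ‖creationFun i x α‖ ^ 2) (a := 0) (c := ‖x‖ ^ 2)
    (b := fun j => if j = i then ‖x‖ ^ 2 else 0) (fun _ => by positivity) s
    (by simp [creationFun])
    (fun j t _ => by
      by_cases hj : j = i
      · simpa [creationFun, hj] using HilbertSum.sum_norm_sq_le x t
      · simp [creationFun, hj])
    (fun r => by
      rw [Finset.sum_ite_eq']
      split_ifs
      · exact le_rfl
      · positivity)
  simpa using this

open Classical in
/-- The (left) creation operator `L_i ⊗ 1` on `Γ ⊗ E`, `e_α ⊗ x ↦ e_i ⊗ e_α ⊗ x`. -/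
def creation (i : ι) : FockTensor ι E →L[ℂ] FockTensor ι E :=
  LinearMap.mkContinuous
    { toFun := fun x => ⟨creationFun i x, HilbertSum.memlp_of_sum_le (creationFun_sum_le i x)⟩
      map_add' := fun x y => by
        refine lp.ext (funext fun α => ?_)
        change creationFun i (x + y : FockTensor ι E) α = creationFun i x α + creationFun i y α
        cases α with
        | nil => simp [creationFun]
        | cons j α => by_cases h : j = i <;> simp [creationFun, h]
      map_smul' := fun c x => by
        ext α
        cases α with
        | nil => simp [creationFun]
        | cons j α => by_cases h : j = i <;> simp [creationFun, h] }
    1 fun x => by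
      rw [one_mul]
      refine le_of_sq_le_sq ?_ (norm_nonneg _)
      exact HilbertSum.norm_sq_le (creationFun_sum_le i x)

end FockTensor

/-- A row contraction on `H` indexed by `ι`: a tuple `T = (T_i)` of bounded operators on `H`
with `∑ T_i T_i^* ≤ 1`, that is, `∑ ‖T_i^* h‖² ≤ ‖h‖²` for all `h`. -/
structure RowContraction (ι : Type*) (H : Type*) [NormedAddCommGroup H] [InnerProductSpace ℂ H]
    [CompleteSpace H] where
  /-- the operators of the tuple -/
  op : ι → H →L[ℂ] H
  /-- `∑ T_i T_i^* ≤ 1` -/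
  sum_le : ∀ (s : Finset ι) (h : H), ∑ i ∈ s, ‖adjoint (op i) h‖ ^ 2 ≤ ‖h‖ ^ 2

namespace RowContraction

variable {ι : Type*} {H : Type*} [NormedAddCommGroup H] [InnerProductSpace ℂ H] [CompleteSpace H]

/-- The tuple is coisometric: `∑ T_i T_i^* = 1`, the sum being taken in the strong operator
topology. -/
def IsCoisometric (T : RowContraction ι H) : Prop :=
  ∀ h, HasSum (fun i => T.op i (adjoint (T.op i) h)) h

/-- The tuple is ergodic: the only fixed points of the completely positive map
`Z(X) = ∑ T_i X T_i^*` on `B(H)` (sum in the strong operator topology) are the multiples of the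
identity. -/
def IsErgodic (T : RowContraction ι H) : Prop :=
  ∀ X : H →L[ℂ] H, (∀ h, HasSum (fun i => T.op i (X (adjoint (T.op i) h))) (X h)) →
    ∃ c : ℂ, X = c • ContinuousLinearMap.id ℂ H

/-- `T_α = T_{α_1} ⋯ T_{α_m}` for a word `α = (α_1, …, α_m)`. -/
def word (T : RowContraction ι H) (α : List ι) : H →L[ℂ] H :=
  (α.map T.op).prod

/-- The tuple is `*`-stable: `∑_{|α| = n} ‖T_α^* h‖² → 0` as `n → ∞`, for all `h`. -/
def IsStarStable (T : RowContraction ι H) : Prop :=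
  ∀ h, Filter.Tendsto
    (fun n : ℕ => ∑' α : {α : List ι // α.length = n}, ‖adjoint (T.word α) h‖ₑ ^ 2)
    Filter.atTop (nhds 0)

/-- The adjoint `T^* : H → ⨁ H`, `h ↦ (T_i^* h)_i`, of the row operator. -/
def column (T : RowContraction ι H) : H →L[ℂ] HilbertSum ι H :=
  LinearMap.mkContinuous
    { toFun := fun h => ⟨fun i => adjoint (T.op i) h,
        HilbertSum.memlp_of_sum_le fun s => T.sum_le s h⟩
      map_add' := fun x y => lp.ext (funext fun i => map_add (adjoint (T.op i)) x y)
      map_smul' := fun c x => lp.ext (funext fun i => map_smul (adjoint (T.op i)) c x) }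
    1 fun h => by
      rw [one_mul]
      refine le_of_sq_le_sq ?_ (norm_nonneg _)
      exact HilbertSum.norm_sq_le fun s => T.sum_le s h

/-- The tuple as a row operator `T : ⨁ H → H`, `(h_i)_i ↦ ∑ T_i h_i`. -/
def row (T : RowContraction ι H) : HilbertSum ι H →L[ℂ] H :=
  adjoint T.column

lemma column_apply (T : RowContraction ι H) (h : H) (i : ι) :
    T.column h i = adjoint (T.op i) h := rfl

lemma row_incl (T : RowContraction ι H) (i : ι) (h : H) :
    T.row (HilbertSum.incl i h) = T.op i h := by
  classical
  refine ext_inner_left ℂ fun k => ?_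
  rw [row, adjoint_inner_right, HilbertSum.incl, lp.singleContinuousLinearMap_apply,
    lp.inner_single_right, column_apply, adjoint_inner_left]

/-- The defect operator `D_* = (1 - T T^*)^{1/2}` on `H`. -/
def defectStar (T : RowContraction ι H) : H →L[ℂ] H :=
  positiveSqrt (1 - T.row ∘L adjoint T.row)

/-- The defect operator `D = (1 - T^* T)^{1/2}` on `⨁ H`. -/
def defect (T : RowContraction ι H) : HilbertSum ι H →L[ℂ] HilbertSum ι H :=
  positiveSqrt (1 - adjoint T.row ∘L T.row)

/-- The defect space `𝒟_*`, the closure of the range of `D_*`. -/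
def defectStarSpace (T : RowContraction ι H) : Submodule ℂ H :=
  T.defectStar.range.topologicalClosure

/-- The defect space `𝒟`, the closure of the range of `D`. -/
def defectSpace (T : RowContraction ι H) : Submodule ℂ (HilbertSum ι H) :=
  T.defect.range.topologicalClosure


lemma positiveSqrt_facts {E : Type*} [NormedAddCommGroup E] [InnerProductSpace ℂ E]
    [CompleteSpace E] {T : E →L[ℂ] E} (hT : 0 ≤ T) :
    IsSelfAdjoint (positiveSqrt T) ∧ ∀ x, positiveSqrt T (positiveSqrt T x) = T x :=
  ⟨(CFC.sqrt_nonneg T).isSelfAdjoint,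
    fun x => congrArg (fun S : E →L[ℂ] E => S x) (CFC.sqrt_mul_sqrt_self T hT)⟩

lemma norm_positiveSqrt_sq {E : Type*} [NormedAddCommGroup E] [InnerProductSpace ℂ E]
    [CompleteSpace E] {T : E →L[ℂ] E} (hT : 0 ≤ T) (x : E) :
    ‖positiveSqrt T x‖ ^ 2 = RCLike.re (inner ℂ x (T x)) := by
  obtain ⟨h1, h2⟩ := positiveSqrt_facts hT
  rw [← h2 x, ← inner_self_eq_norm_sq (𝕜 := ℂ)]
  conv_lhs => rw [← h1.adjoint_eq]
  rw [adjoint_inner_left, h1.adjoint_eq]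

lemma adjoint_row (T : RowContraction ι H) : adjoint T.row = T.column := adjoint_adjoint _

lemma norm_column_le (T : RowContraction ι H) (h : H) : ‖T.column h‖ ≤ ‖h‖ := by
  refine le_of_sq_le_sq ?_ (norm_nonneg _)
  exact HilbertSum.norm_sq_le fun s => T.sum_le s h

lemma norm_row_le (T : RowContraction ι H) (x : HilbertSum ι H) : ‖T.row x‖ ≤ ‖x‖ := by
  have h1 : ‖T.row‖ ≤ 1 := by
    rw [row, LinearIsometryEquiv.norm_map]
    exact opNorm_le_bound _ zero_le_one fun h => by simpa using T.norm_column_le h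
  simpa using T.row.le_of_opNorm_le h1 x

lemma one_sub_nonneg {E F : Type*} [NormedAddCommGroup E] [InnerProductSpace ℂ E]
    [CompleteSpace E] [NormedAddCommGroup F] [InnerProductSpace ℂ F] [CompleteSpace F]
    (S : E →L[ℂ] F) (hS : ∀ x, ‖S x‖ ≤ ‖x‖) : 0 ≤ 1 - adjoint S ∘L S := by
  rw [nonneg_iff_isPositive]
  refine ⟨?_, fun x => ?_⟩
  · intro x y
    simp [inner_sub_left, inner_sub_right, adjoint_inner_left, adjoint_inner_right]
  · have := pow_le_pow_left₀ (norm_nonneg _) (hS x) 2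
    simp only [reApplyInnerSelf, sub_apply, one_apply_eq_self, coe_comp, Function.comp,
      inner_sub_left, adjoint_inner_left, map_sub, inner_self_eq_norm_sq]
    linarith

lemma one_sub_row_nonneg (T : RowContraction ι H) : 0 ≤ 1 - T.row ∘L adjoint T.row := by
  simpa [adjoint_row, row] using one_sub_nonneg T.column T.norm_column_le

lemma norm_defectStar_sq (T : RowContraction ι H) (h : H) :
    ‖T.defectStar h‖ ^ 2 = ‖h‖ ^ 2 - ‖T.column h‖ ^ 2 := by
  rw [defectStar, norm_positiveSqrt_sq T.one_sub_row_nonneg]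
  simp only [sub_apply, one_apply_eq_self, coe_comp, Function.comp, inner_sub_right, row,
    adjoint_adjoint, map_sub, inner_self_eq_norm_sq]
  rw [← adjoint_inner_left, adjoint_adjoint, inner_self_eq_norm_sq]

lemma norm_defect_le (T : RowContraction ι H) (x : HilbertSum ι H) : ‖T.defect x‖ ≤ ‖x‖ := by
  refine le_of_sq_le_sq ?_ (norm_nonneg _)
  rw [defect, norm_positiveSqrt_sq (one_sub_nonneg T.row T.norm_row_le)]
  simp only [sub_apply, one_apply_eq_self, coe_comp, Function.comp, inner_sub_right,
    adjoint_inner_right, map_sub, inner_self_eq_norm_sq]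
  linarith [sq_nonneg ‖T.row x‖]

/-- The operator `T` maps `𝒟` to `𝒟_*` -/
lemma row_mem (T : RowContraction ι H) {f : HilbertSum ι H} (hf : f ∈ T.defectSpace) :
    T.row f ∈ T.defectStarSpace := by
  obtain ⟨hs, hs2⟩ := positiveSqrt_facts T.one_sub_row_nonneg
  obtain ⟨hd, hd2⟩ := positiveSqrt_facts (one_sub_nonneg T.row T.norm_row_le)
  change IsSelfAdjoint T.defectStar at hs
  change IsSelfAdjoint T.defect at hd
  suffices h : T.defectSpace ≤ T.defectStarSpace.comap T.row.toLinearMap from h hf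
  refine Submodule.topologicalClosure_minimal _ ?_
    ((Submodule.isClosed_topologicalClosure _).preimage T.row.continuous)
  rintro _ ⟨g, rfl⟩
  rw [Submodule.mem_comap, defectStarSpace,
    ← Submodule.orthogonal_orthogonal_eq_closure, Submodule.mem_orthogonal]
  intro k hk
  have hk0 : T.defectStar k = 0 := by
    refine ext_inner_left ℂ fun v => ?_
    rw [inner_zero_right, ← hs.adjoint_eq, adjoint_inner_right]
    exact (Submodule.mem_orthogonal _ _).1 hk _ ⟨v, rfl⟩
  have hk1 : T.row (adjoint T.row k) = k := by
    have := hs2 k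
    change T.defectStar (T.defectStar k) = _ at this
    rw [hk0, map_zero] at this
    have h2 : 0 = k - T.row (adjoint T.row k) := by simpa using this
    exact (sub_eq_zero.1 h2.symm).symm
  have hk2 : T.defect (adjoint T.row k) = 0 := by
    have h3 : ‖T.defect (adjoint T.row k)‖ ^ 2 = 0 := by
      rw [defect, norm_positiveSqrt_sq (one_sub_nonneg T.row T.norm_row_le)]
      simp [hk1]
    simpa using h3
  change inner ℂ k (T.row (T.defect g)) = 0
  rw [← adjoint_inner_left, ← adjoint_inner_left, hd.adjoint_eq, hk2, inner_zero_left]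

lemma defectStar_mem (T : RowContraction ι H) (h : H) : T.defectStar h ∈ T.defectStarSpace :=
  Submodule.le_topologicalClosure _ ⟨h, rfl⟩

lemma defect_mem (T : RowContraction ι H) (x : HilbertSum ι H) : T.defect x ∈ T.defectSpace :=
  Submodule.le_topologicalClosure _ ⟨x, rfl⟩

/-- `D_*` as an operator `H → 𝒟_*`. -/
def defectStarMap (T : RowContraction ι H) : H →L[ℂ] T.defectStarSpace :=
  T.defectStar.codRestrict _ T.defectStar_mem

/-- `D` as an operator `⨁ H → 𝒟`. -/
def defectMap (T : RowContraction ι H) : HilbertSum ι H →L[ℂ] T.defectSpace :=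
  T.defect.codRestrict _ T.defect_mem

lemma adjoint_word_cons (T : RowContraction ι H) (i : ι) (α : List ι) (h : H) :
    adjoint (T.word (i :: α)) h = adjoint (T.word α) (adjoint (T.op i) h) := by
  have : T.word (i :: α) = T.op i ∘L T.word α := by simp [word, mul_def]
  rw [this, adjoint_comp, comp_apply]

lemma poisson_sum_le (T : RowContraction ι H) (h : H) (s : Finset (List ι)) :
    ∑ α ∈ s, ‖T.defectStarMap (adjoint (T.word α) h)‖ ^ 2 ≤ ‖h‖ ^ 2 := by
  have key : ∀ (n : ℕ) (h : H) (s : Finset (List ι)), (∀ α ∈ s, α.length < n) →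
      ∑ α ∈ s, ‖T.defectStarMap (adjoint (T.word α) h)‖ ^ 2 ≤ ‖h‖ ^ 2 := by
    intro n
    induction n with
    | zero =>
      intro h s hs
      have : s = ∅ := Finset.eq_empty_of_forall_notMem fun α hα => by simpa using hs α hα
      subst this
      simp
    | succ n ih =>
      intro h s hs
      refine (FockTensor.sum_word_le (a := ‖T.defectStar h‖ ^ 2) (c := ‖T.column h‖ ^ 2)
        (b := fun i => ‖adjoint (T.op i) h‖ ^ 2) (fun _ => by positivity) s ?_ ?_ ?_).trans ?_
      · have : adjoint (T.word []) h = h := by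
          have h1 : adjoint (T.word []) = 1 := by simp [word, ← star_eq_adjoint]
          rw [h1, one_apply_eq_self]
        rw [this]
        exact le_rfl
      · intro i t ht
        simp_rw [adjoint_word_cons]
        exact ih _ t fun β hβ => by simpa using hs _ (ht β hβ)
      · exact fun r => HilbertSum.sum_norm_sq_le (T.column h) r
      · rw [norm_defectStar_sq]; linarith
  refine key (s.sup List.length + 1) h s fun α hα => ?_
  exact Nat.lt_succ_of_le (Finset.le_sup (f := List.length) hα)

/-- The Poisson kernel `C : H → Γ ⊗ 𝒟_*`, `C h = ∑_α e_α ⊗ D_* T_α^* h`. -/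
def poissonKernel (T : RowContraction ι H) : H →ₗ[ℂ] FockTensor ι T.defectStarSpace where
  toFun h := ⟨fun α => T.defectStarMap (adjoint (T.word α) h),
    HilbertSum.memlp_of_sum_le (T.poisson_sum_le h)⟩
  map_add' x y := lp.ext (funext fun α =>
    map_add (T.defectStarMap ∘L adjoint (T.word α)) x y)
  map_smul' c x := lp.ext (funext fun α =>
    map_smul (T.defectStarMap ∘L adjoint (T.word α)) c x)

/-- The coordinates of the value at `f` of the characteristic function. -/
def charFunCoord (T : RowContraction ι H) (f : T.defectSpace) : List ι → T.defectStarSpace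
  | [] => -⟨T.row f, T.row_mem f.2⟩
  | j :: α => T.defectStarMap (adjoint (T.word α) (T.defect f j))

lemma charFunCoord_sum_le (T : RowContraction ι H) (f : T.defectSpace) (s : Finset (List ι)) :
    ∑ α ∈ s, ‖T.charFunCoord f α‖ ^ 2 ≤ ‖f‖ ^ 2 + ‖f‖ ^ 2 := by
  refine (FockTensor.sum_word_le (a := ‖f‖ ^ 2) (c := ‖f‖ ^ 2)
    (b := fun j => ‖T.defect f j‖ ^ 2) (fun _ => by positivity) s ?_ ?_ ?_)
  · simp only [charFunCoord, norm_neg]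
    exact pow_le_pow_left₀ (norm_nonneg _) (T.norm_row_le f) 2
  · exact fun j t _ => T.poisson_sum_le _ t
  · intro r
    refine (HilbertSum.sum_norm_sq_le (T.defect f) r).trans ?_
    exact pow_le_pow_left₀ (norm_nonneg _) (T.norm_defect_le f) 2

/-- Popescu's characteristic function (symbol) `θ_T : 𝒟 → Γ ⊗ 𝒟_*`,
`θ_T f = -e_0 ⊗ ∑_j T_j P_j f + ∑_j e_j ⊗ ∑_α e_α ⊗ D_* T_α^* P_j D f`. -/
def charFun (T : RowContraction ι H) : T.defectSpace →ₗ[ℂ] FockTensor ι T.defectStarSpace where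
  toFun f := ⟨T.charFunCoord f, HilbertSum.memlp_of_sum_le (T.charFunCoord_sum_le f)⟩
  map_add' x y := by
    refine lp.ext (funext fun α => ?_)
    change T.charFunCoord (x + y) α = T.charFunCoord x α + T.charFunCoord y α
    cases α with
    | nil => ext; simp [charFunCoord]; abel
    | cons j α => simp [charFunCoord]
  map_smul' c x := by
    refine lp.ext (funext fun α => ?_)
    change T.charFunCoord (c • x) α = c • T.charFunCoord x α
    cases α with
    | nil => ext; simp [charFunCoord]
    | cons j α => simp [charFunCoord]

/-- The space `H ⊕ (Γ ⊗ 𝒟)` of the minimal isometric dilation. -/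
abbrev DilationSpace (T : RowContraction ι H) : Type _ :=
  WithLp 2 (H × FockTensor ι T.defectSpace)

/-- The operators of Popescu's minimal isometric dilation on `H ⊕ (Γ ⊗ 𝒟)`,
`V_i (h ⊕ x) = T_i h ⊕ (e_0 ⊗ D_i h + e_i ⊗ x)`, where `D_i h = D (0, …, 0, h, 0, …, 0)` with `h`
in the `i`-th place. -/
def dilation (T : RowContraction ι H) (i : ι) : T.DilationSpace →ₗ[ℂ] T.DilationSpace where
  toFun v := WithLp.toLp 2 (T.op i v.fst,
    HilbertSum.incl [] (T.defectMap (HilbertSum.incl i v.fst)) + FockTensor.creation i v.snd)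
  map_add' x y := by
    refine WithLp.ofLp_injective 2 (Prod.ext ?_ ?_)
    · simp
    · simp only [WithLp.add_fst, WithLp.add_snd, map_add, WithLp.ofLp_add, Prod.snd_add]
      abel
  map_smul' c x := by
    refine WithLp.ofLp_injective 2 (Prod.ext ?_ ?_) <;> simp

/-- A tuple `ω` of scalars with `∑ |ω_i|² = 1`, as a row contraction on `ℂ`. -/
def scalar (ω : ι → ℂ) (hω : HasSum (fun i => ‖ω i‖ ^ 2) 1) : RowContraction ι ℂ where
  op i := ω i • ContinuousLinearMap.id ℂ ℂ
  sum_le s z := by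
    have := sum_le_hasSum s (fun _ _ => by positivity) hω
    have h2 : ∀ i, ‖adjoint (ω i • ContinuousLinearMap.id ℂ ℂ) z‖ ^ 2 = ‖ω i‖ ^ 2 * ‖z‖ ^ 2 := by
      intro i
      have h1 : (ContinuousLinearMap.id ℂ ℂ) = 1 := rfl
      rw [h1, ← star_eq_adjoint, star_smul, star_one]
      simp [mul_pow]
    simp_rw [h2, ← Finset.sum_mul]
    nlinarith [sq_nonneg ‖z‖]

/-- The compression `(P_K T_i|_K)` of the tuple to a closed subspace `K`. -/
def compression (T : RowContraction ι H) (K : Submodule ℂ H) [CompleteSpace K] :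
    RowContraction ι K where
  op i := K.orthogonalProjectionOnto ∘L T.op i ∘L K.subtypeL
  sum_le s h := by
    refine (Finset.sum_le_sum fun i _ => ?_).trans (T.sum_le s h)
    rw [adjoint_comp, adjoint_comp, Submodule.adjoint_subtypeL,
      Submodule.adjoint_orthogonalProjectionOnto]
    exact pow_le_pow_left₀ (norm_nonneg _)
      (K.norm_orthogonalProjectionOnto_apply_le _) 2

/-- The compression `Å` of the tuple to the orthogonal complement `H° = H ⊖ ℂΩ`. -/
abbrev reduced (A : RowContraction ι H) (Ω : H) : RowContraction ι (ℂ ∙ Ω)ᗮ :=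
  A.compression (ℂ ∙ Ω)ᗮ

/-- The operator `D̂_* h = (⟨Ω| ⊗ 1) (∑ A_i^* h ⊗ ε_i) = ∑ ⟨Ω, A_i^* h⟩ ε_i` on `H° = H ⊖ ℂΩ`, with
values in `ℓ²(ι)`, where `(ε_i)` is the standard orthonormal basis. -/
def hatDefectStar (A : RowContraction ι H) (Ω : H) : (ℂ ∙ Ω)ᗮ →L[ℂ] HilbertSum ι ℂ :=
  HilbertSum.ampliation (innerSL ℂ Ω) ∘L A.column ∘L (ℂ ∙ Ω)ᗮ.subtypeL

lemma hatDefectStar_apply (A : RowContraction ι H) (Ω : H) (h : (ℂ ∙ Ω)ᗮ) (i : ι) :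
    A.hatDefectStar Ω h i = inner ℂ Ω (adjoint (A.op i) h) := rfl

/-- The unitary `W` intertwining two minimal isometric dilations: `W V_i = Ṽ_i W` for all `i`,
with the normalization `W Ω = Ω'` on the distinguished vectors. -/
structure IsDilationIntertwiner {H' : Type*} [NormedAddCommGroup H'] [InnerProductSpace ℂ H']
    [CompleteSpace H'] (A : RowContraction ι H) (B : RowContraction ι H') (Ω : H) (Ω' : H')
    (W : A.DilationSpace ≃ₗᵢ[ℂ] B.DilationSpace) : Prop where
  /-- `W V_i = Ṽ_i W` -/
  intertwines : ∀ i v, W (A.dilation i v) = B.dilation i (W v)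
  /-- `W Ω = Ω'` -/
  map_vector : W (WithLp.toLp 2 (Ω, 0)) = WithLp.toLp 2 (Ω', 0)

/-- The embedding `H → H ⊕ (Γ ⊗ 𝒟)`. -/
def inclBase (T : RowContraction ι H) : H →ₗ[ℂ] T.DilationSpace :=
  (WithLp.linearEquiv 2 ℂ (H × FockTensor ι T.defectSpace)).symm.toLinearMap ∘ₗ
    LinearMap.inl ℂ H (FockTensor ι T.defectSpace)

/-- The embedding `Γ ⊗ 𝒟 → H ⊕ (Γ ⊗ 𝒟)`. -/
def inclFock (T : RowContraction ι H) : FockTensor ι T.defectSpace →ₗ[ℂ] T.DilationSpace :=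
  (WithLp.linearEquiv 2 ℂ (H × FockTensor ι T.defectSpace)).symm.toLinearMap ∘ₗ
    LinearMap.inr ℂ H (FockTensor ι T.defectSpace)

/-- `Ĉ = W|_H`. -/
def hatPoisson {H' : Type*} [NormedAddCommGroup H'] [InnerProductSpace ℂ H'] [CompleteSpace H']
    {A : RowContraction ι H} {B : RowContraction ι H'}
    (W : A.DilationSpace ≃ₗᵢ[ℂ] B.DilationSpace) : H →ₗ[ℂ] B.DilationSpace :=
  W.toLinearEquiv.toLinearMap ∘ₗ A.inclBase

/-- The symbol `θ̂ = W|_{e_0 ⊗ 𝒟}` of the extended characteristic function, `e_0 ⊗ 𝒟` being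
identified with `𝒟`. (When `W` is the normalized intertwiner onto the dilation of a tuple of
scalars, the values lie in `Γ ⊗ 𝒟_ω`, as this is the orthogonal complement of `W Ω`.) -/
def extendedCharFun {H' : Type*} [NormedAddCommGroup H'] [InnerProductSpace ℂ H']
    [CompleteSpace H'] {A : RowContraction ι H} {B : RowContraction ι H'}
    (W : A.DilationSpace ≃ₗᵢ[ℂ] B.DilationSpace) : A.defectSpace →ₗ[ℂ] B.DilationSpace :=
  W.toLinearEquiv.toLinearMap ∘ₗ A.inclFock ∘ₗ (HilbertSum.incl []).toLinearMap

end RowContraction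
end

/-!
Write `V` for the minimal isometric dilation of `A`. As `V_i^*` restricts to `A_i^*` on `H`, the
vector `Ω` is a common eigenvector of the `V_i^*`, and the Gram matrix of its orbit `(V_α Ω)_α` is
determined by `ω` alone (`IsRowEigenvector.inner_orbit_eq`). The vector `1 ∈ ℂ` has the same
property in the dilation of `ω`. Thus `V_α Ω ↦ V^ω_α 1` extends to a unitary, the only possible
`W`, as soon as both orbits span dense subspaces (`IsRowEigenvector.existsUnique_unitary`).

Density for `A` is where ergodicity enters (`orbit_dense_of_isErgodic`). The projection `Q` onto the
closed span of the orbit commutes with every `V_i`. Since `A` is coisometric, `h = ∑ V_i A_i^* h`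
for `h ∈ H`, so the compression `X` of `Q` to `H` satisfies `X = ∑ A_i X A_i^*`. By ergodicity `X` is
a scalar, and `X Ω = Ω` shows that `X = 1`; hence the closed span contains `H`, which generates the
dilation space.

Splitting `A_i^* h = ⟨Ω, A_i^* h⟩ Ω + Å_i^* h` for `h ⟂ Ω` gives `‖D̊_* h‖ = ‖D̂_* h‖`, hence `γ`.
The same splitting, fed into `W h = ∑ V_i^ω W A_i^* h`, yields the coordinates of `W h` by recursion
on words: the one at `α` is `D̂_* Å_α^* h`, so that `Ĉ = (1 ⊗ γ) C̊`
(`IsDilationIntertwiner.snd_apply`). The formula for `θ̂` follows from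
`e_0 ⊗ D_A h^{(i)} = V_i h - A_i h` and the corresponding identity
`θ_T (D h^{(i)}) = e_i ⊗ C h - C T_i h` for `T = Å` (`charFun_defectMap_incl`).

Finally `*`-stability is a consequence: `C̊` is isometric because `W` and `1 ⊗ γ` are, and
`∑_{|α| = n} ‖Å_α^* h‖²` is then the tail of a convergent series
(`isStarStable_of_norm_poissonKernel`).
-/

noncomputable section

open ContinuousLinearMap
open scoped ENNReal

/-! ### Square roots of positive operators -/

section SquareRoot

variable {E F : Type*} [NormedAddCommGroup E] [InnerProductSpace ℂ E] [CompleteSpace E]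
  [NormedAddCommGroup F] [InnerProductSpace ℂ F] [CompleteSpace F]

/-- If `C S + S B = 0` with `B, C ≥ 0`, then `S^* S B = -S^* C S`. The left side is a product of
commuting positive operators, the right side is negative, so both vanish. -/
lemma eq_zero_of_positive_sylvester {B : E →L[ℂ] E} {C : F →L[ℂ] F} (hB : 0 ≤ B) (hC : 0 ≤ C)
    {S : E →L[ℂ] F} (h : C ∘L S + S ∘L B = 0) : C ∘L S = 0 ∧ S ∘L B = 0 := by
  set P : E →L[ℂ] E := adjoint S ∘L S with hP
  have hP0 : 0 ≤ P := (nonneg_iff_isPositive _).2 (isPositive_adjoint_comp_self S)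
  have hN0 : 0 ≤ adjoint S ∘L C ∘L S := by
    rw [nonneg_iff_isPositive]
    exact ((nonneg_iff_isPositive C).1 hC).adjoint_conj S
  have hSB : S ∘L B = -(C ∘L S) := (neg_eq_of_add_eq_zero_right h).symm
  have hPB : P * B = -(adjoint S ∘L C ∘L S) := by
    rw [mul_def, hP, comp_assoc, hSB, comp_neg]
  -- `S^* C S` is self-adjoint, hence so is `P B`, and `P` commutes with `B`
  have hcomm : Commute P B := by
    have h1 : star (P * B) = P * B := by
      rw [hPB, star_neg, (IsSelfAdjoint.of_nonneg hN0).star_eq]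
    rw [star_mul, (IsSelfAdjoint.of_nonneg hP0).star_eq, (IsSelfAdjoint.of_nonneg hB).star_eq] at h1
    exact h1.symm
  have hPB0 : P * B = 0 := by
    refine le_antisymm ?_ (hcomm.mul_nonneg hP0 hB)
    rw [hPB]
    exact neg_nonpos.2 hN0
  have hz : S ∘L B = 0 := by
    ext x
    have h2 : ‖S (B x)‖ ^ 2 = 0 := by
      have h3 : P (B x) = 0 := congrArg (fun R : E →L[ℂ] E => R x) hPB0
      rw [← inner_self_eq_norm_sq (𝕜 := ℂ), ← adjoint_inner_left]
      change RCLike.re (inner ℂ (P (B x)) (B x)) = 0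
      rw [h3, inner_zero_left, map_zero]
    simpa using h2
  exact ⟨by simpa [hz] using h, hz⟩

/-- The defect operators `B`, `C` of a contraction `T` satisfy `T B² = C² T`; taking square roots
preserves this intertwining relation. With `S = T B - C T` one has `C S + S B = 0`, and such a
Sylvester equation with positive coefficients forces `C S = 0 = S B`, whence `S^* S = 0`. -/
lemma comp_eq_comp_of_sq_comp {B : E →L[ℂ] E} {C : F →L[ℂ] F} (hB : 0 ≤ B) (hC : 0 ≤ C)
    (T : E →L[ℂ] F) (h : T ∘L (B ∘L B) = (C ∘L C) ∘L T) : T ∘L B = C ∘L T := by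
  have hBs : adjoint B = B := (IsSelfAdjoint.of_nonneg hB).adjoint_eq
  have hCs : adjoint C = C := (IsSelfAdjoint.of_nonneg hC).adjoint_eq
  set S : E →L[ℂ] F := T ∘L B - C ∘L T with hS
  obtain ⟨h1, h2⟩ := eq_zero_of_positive_sylvester hB hC (S := S) (by
    ext x
    have := congrArg (fun R : E →L[ℂ] F => R x) h
    simp only [comp_apply] at this
    simp [hS, this])
  have h3 : ∀ x, S (B x) = 0 := fun x => congrArg (fun R : E →L[ℂ] F => R x) h2
  have h4 : ∀ x, C (S x) = 0 := fun x => congrArg (fun R : E →L[ℂ] F => R x) h1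
  -- `S^* S = S^* T B`, and multiplying by `S^* S` from the right gives zero
  have h5 : ∀ x y, inner ℂ (S x) (S y) = inner ℂ (S x) (T (B y)) := by
    intro x y
    have : inner ℂ (S x) (C (T y)) = 0 := by
      rw [← hCs, adjoint_inner_right, h4, inner_zero_left]
    conv_lhs => rw [show S y = T (B y) - C (T y) from rfl]
    rw [inner_sub_right, this, sub_zero]
  have h6 : ∀ y, B (adjoint S (S y)) = 0 := fun y => by
    refine ext_inner_right ℂ fun z => ?_
    conv_lhs => rw [← hBs]
    rw [adjoint_inner_left, adjoint_inner_left, h3, inner_zero_right, inner_zero_left]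
  have h7 : ∀ y, adjoint S (S y) = 0 := fun y => by
    have h8 := h5 y (adjoint S (S y))
    rw [h6, map_zero, inner_zero_right, ← adjoint_inner_left] at h8
    exact inner_self_eq_zero.1 h8
  rw [← sub_eq_zero, ← hS]
  ext y
  have h9 : inner ℂ (S y) (S y) = (0 : ℂ) := by
    rw [← adjoint_inner_left, h7, inner_zero_left]
  simpa using h9

lemma positiveSqrt_eq_self {P : E →L[ℂ] E} (hP : 0 ≤ P) (h : P ∘L P = P) : positiveSqrt P = P :=
  CFC.sqrt_unique h hP

end SquareRoot

lemma denseRange_codRestrict_topologicalClosure {E F : Type*} [NormedAddCommGroup E]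
    [InnerProductSpace ℂ E] [NormedAddCommGroup F] [InnerProductSpace ℂ F] (S : E →L[ℂ] F)
    (h : ∀ x, S x ∈ S.range.topologicalClosure) :
    DenseRange (S.codRestrict S.range.topologicalClosure h) := by
  intro f
  rw [closure_subtype]
  have hf := f.2
  rw [← SetLike.mem_coe, Submodule.topologicalClosure_coe] at hf
  convert! hf using 2
  ext y
  constructor
  · rintro ⟨_, ⟨x, rfl⟩, rfl⟩; exact ⟨x, rfl⟩
  · rintro ⟨x, rfl⟩; exact ⟨_, ⟨x, rfl⟩, rfl⟩

/-! ### Common eigenvectors of the adjoints of a row isometry -/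

section CyclicEigenvector

variable {ι : Type*} {K : Type*} [NormedAddCommGroup K] [InnerProductSpace ℂ K]

/-- Isometries `V i` with mutually orthogonal ranges, with a unit vector `Ω` that is a common
eigenvector of their adjoints: `V_i^* Ω = \bar ω_i Ω`. -/
structure IsRowEigenvector (V : ι → K →ₗ[ℂ] K) (ω : ι → ℂ) (Ω : K) : Prop where
  norm_op : ∀ i x, ‖V i x‖ = ‖x‖
  inner_op : ∀ i j x y, i ≠ j → inner ℂ (V i x) (V j y) = 0
  inner_vec : ∀ i x, inner ℂ Ω (V i x) = ω i * inner ℂ Ω x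
  norm_vec : ‖Ω‖ = 1

/-- The vector `V_{α_1} ⋯ V_{α_m} Ω`. -/
def orbit (V : ι → K →ₗ[ℂ] K) (Ω : K) (α : List ι) : K :=
  α.foldr (fun i x => V i x) Ω

lemma orbit_cons (V : ι → K →ₗ[ℂ] K) (Ω : K) (i : ι) (α : List ι) :
    orbit V Ω (i :: α) = V i (orbit V Ω α) := rfl

namespace IsRowEigenvector

variable {V : ι → K →ₗ[ℂ] K} {ω : ι → ℂ} {Ω : K}

lemma inner_op_self (h : IsRowEigenvector V ω Ω) (i : ι) (x y : K) :
    inner ℂ (V i x) (V i y) = inner ℂ x y :=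
  (LinearMap.norm_map_iff_inner_map_map (V i)).1 (h.norm_op i) x y

lemma continuous_op (h : IsRowEigenvector V ω Ω) (i : ι) : Continuous (V i) :=
  (LinearIsometry.mk (V i) (h.norm_op i)).continuous

variable {K' : Type*} [NormedAddCommGroup K'] [InnerProductSpace ℂ K']
  {V' : ι → K' →ₗ[ℂ] K'} {Ω' : K'}

lemma inner_orbit_eq (h : IsRowEigenvector V ω Ω) (h' : IsRowEigenvector V' ω Ω')
    (α β : List ι) :
    inner ℂ (orbit V Ω α) (orbit V Ω β) = inner ℂ (orbit V' Ω' α) (orbit V' Ω' β) := by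
  have hvac : ∀ β, inner ℂ Ω (orbit V Ω β) = inner ℂ Ω' (orbit V' Ω' β) := by
    intro β
    induction β with
    | nil => simp [orbit, h.norm_vec, h'.norm_vec]
    | cons j β ih => rw [orbit_cons, orbit_cons, h.inner_vec, h'.inner_vec, ih]
  induction α generalizing β with
  | nil => exact hvac β
  | cons i α ih =>
    cases β with
    | nil =>
      rw [← inner_conj_symm, ← inner_conj_symm (orbit V' Ω' (i :: α))]
      exact congrArg _ (hvac (i :: α))
    | cons j β =>
      simp only [orbit_cons]
      by_cases hij : i = j
      · subst hij
        rw [h.inner_op_self, h'.inner_op_self, ih]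
      · rw [h.inner_op i j _ _ hij, h'.inner_op i j _ _ hij]

/-- The Gram matrix of the orbit of `Ω` depends only on `ω`, so two cyclic row eigenvectors with
the same eigenvalues are unitarily equivalent, by exactly one unitary. -/
lemma existsUnique_unitary [CompleteSpace K] [CompleteSpace K'] (h : IsRowEigenvector V ω Ω)
    (h' : IsRowEigenvector V' ω Ω')
    (hd : (Submodule.span ℂ (Set.range (orbit V Ω))).topologicalClosure = ⊤)
    (hd' : (Submodule.span ℂ (Set.range (orbit V' Ω'))).topologicalClosure = ⊤) :
    ∃! W : K ≃ₗᵢ[ℂ] K', (∀ i x, W (V i x) = V' i (W x)) ∧ W Ω = Ω' := by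
  have hr : DenseRange (Finsupp.linearCombination ℂ (orbit V Ω)) := by
    rw [DenseRange, ← LinearMap.coe_range, Finsupp.range_linearCombination]
    exact Submodule.dense_iff_topologicalClosure_eq_top.2 hd
  have hr' : DenseRange (Finsupp.linearCombination ℂ (orbit V' Ω')) := by
    rw [DenseRange, ← LinearMap.coe_range, Finsupp.range_linearCombination]
    exact Submodule.dense_iff_topologicalClosure_eq_top.2 hd'
  have hext : ∀ {f g : K → K'}, Continuous f → Continuous g →
      (∀ c, f (Finsupp.linearCombination ℂ (orbit V Ω) c) =
        g (Finsupp.linearCombination ℂ (orbit V Ω) c)) → ∀ x, f x = g x :=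
    fun hf hg hfg x => congrFun (hr.equalizer hf hg (funext hfg)) x
  have hnorm : ∀ c : List ι →₀ ℂ,
      ‖Finsupp.linearCombination ℂ (orbit V' Ω') (LinearEquiv.refl ℂ _ c)‖ =
        ‖Finsupp.linearCombination ℂ (orbit V Ω) c‖ := by
    intro c
    rw [← sq_eq_sq₀ (norm_nonneg _) (norm_nonneg _), ← inner_self_eq_norm_sq (𝕜 := ℂ),
      ← inner_self_eq_norm_sq (𝕜 := ℂ)]
    simp only [LinearEquiv.refl_apply, Finsupp.linearCombination_apply, Finsupp.sum_inner,
      Finsupp.inner_sum, h.inner_orbit_eq h', inner_smul_left, inner_smul_right]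
  let W : K ≃ₗᵢ[ℂ] K' := (LinearEquiv.refl ℂ (List ι →₀ ℂ)).extendOfIsometry _ _ hr hr' hnorm
  have hW : ∀ c, W (Finsupp.linearCombination ℂ (orbit V Ω) c) =
      Finsupp.linearCombination ℂ (orbit V' Ω') c :=
    fun c => LinearEquiv.extendOfIsometry_eq _ _ _ hr hr' hnorm c
  have hWo : ∀ α, W (orbit V Ω α) = orbit V' Ω' α := fun α => by
    simpa using hW (Finsupp.single α 1)
  refine ⟨W, ⟨fun i => ?_, hWo []⟩, ?_⟩
  · refine hext (W.continuous.comp (h.continuous_op i)) ((h'.continuous_op i).comp W.continuous)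
      fun c => ?_
    rw [hW]
    simp only [Finsupp.linearCombination_apply, Finsupp.sum, map_sum, map_smul,
      ← orbit_cons, hWo]
  · rintro U ⟨hU, hUΩ⟩
    have hUo : ∀ α, U (orbit V Ω α) = orbit V' Ω' α := by
      intro α
      induction α with
      | nil => exact hUΩ
      | cons i α ih => rw [orbit_cons, orbit_cons, hU, ih]
    refine LinearIsometryEquiv.ext (hext U.continuous W.continuous fun c => ?_)
    rw [hW]
    simp only [Finsupp.linearCombination_apply, Finsupp.sum, map_sum, map_smul, hUo]

/-- The projection onto the closed span of the orbit of `Ω` commutes with the isometries. -/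
lemma starProjection_op [CompleteSpace K] (h : IsRowEigenvector V ω Ω) (i : ι) (x : K) :
    (Submodule.span ℂ (Set.range (orbit V Ω))).topologicalClosure.starProjection (V i x) =
      V i ((Submodule.span ℂ (Set.range (orbit V Ω))).topologicalClosure.starProjection x) := by
  set M := Submodule.span ℂ (Set.range (orbit V Ω)) with hM
  have horb : ∀ α, orbit V Ω α ∈ M := fun α => Submodule.subset_span ⟨α, rfl⟩
  refine Submodule.eq_starProjection_of_mem_orthogonal (K := M.topologicalClosure) ?_ ?_
  · have : M.topologicalClosure ≤ M.topologicalClosure.comap (V i) := by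
      refine Submodule.topologicalClosure_minimal _ (Submodule.span_le.2 ?_)
        (M.isClosed_topologicalClosure.preimage (h.continuous_op i))
      rintro _ ⟨α, rfl⟩
      exact M.le_topologicalClosure (horb (i :: α))
    exact this (Submodule.starProjection_apply_mem _ x)
  · rw [← map_sub, Submodule.orthogonal_closure]
    have hy := M.topologicalClosure.sub_starProjection_mem_orthogonal x
    rw [Submodule.orthogonal_closure] at hy
    have ho : ∀ α, inner ℂ (orbit V Ω α) (x - M.topologicalClosure.starProjection x) = 0 :=
      fun α => (Submodule.mem_orthogonal _ _).1 hy _ (horb α)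
    suffices M ≤ (ℂ ∙ V i (x - M.topologicalClosure.starProjection x))ᗮ by
      rw [Submodule.mem_orthogonal]
      exact fun u hu => Submodule.mem_orthogonal_singleton_iff_inner_left.1 (this hu)
    refine Submodule.span_le.2 ?_
    rintro _ ⟨α, rfl⟩
    rw [SetLike.mem_coe, Submodule.mem_orthogonal_singleton_iff_inner_left]
    cases α with
    | nil =>
      have := ho []
      change inner ℂ Ω _ = 0 at this
      change inner ℂ Ω _ = 0
      rw [h.inner_vec, this, mul_zero]
    | cons j α =>
      rw [orbit_cons]
      by_cases hij : j = i
      · subst hij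
        rw [h.inner_op_self, ho]
      · exact h.inner_op j i _ _ hij

end IsRowEigenvector

end CyclicEigenvector

/-! ### Hilbert sums and Fock spaces -/

namespace HilbertSum

variable {ι : Type*} {E F : Type*} [NormedAddCommGroup E] [InnerProductSpace ℂ E]
  [NormedAddCommGroup F] [InnerProductSpace ℂ F]

lemma incl_apply_self (i : ι) (x : E) : incl i x i = x := by
  classical
  exact lp.single_apply_self (E := fun _ : ι => E) 2 i x

lemma incl_apply_ne {i j : ι} (h : j ≠ i) (x : E) : incl i x j = 0 := by
  classical
  exact lp.single_apply_ne (E := fun _ : ι => E) 2 i x h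

lemma inner_incl_left (i : ι) (x : E) (y : HilbertSum ι E) :
    inner ℂ (incl i x) y = inner ℂ x (y i) := by
  classical
  rw [incl, lp.singleContinuousLinearMap_apply, lp.inner_single_left]

lemma inner_incl_right (i : ι) (x : E) (y : HilbertSum ι E) :
    inner ℂ y (incl i x) = inner ℂ (y i) x := by
  classical
  rw [incl, lp.singleContinuousLinearMap_apply, lp.inner_single_right]

lemma hasSum_incl (x : HilbertSum ι E) : HasSum (fun i => incl i (x i)) x := by
  classical
  exact lp.hasSum_single (p := 2) (by norm_num) x

lemma norm_ampliation (T : E →ₗᵢ[ℂ] F) (x : HilbertSum ι E) :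
    ‖ampliation T.toContinuousLinearMap x‖ = ‖x‖ := by
  rw [← sq_eq_sq₀ (norm_nonneg _) (norm_nonneg _)]
  refine (norm_sq_eq _).unique ((norm_sq_eq x).congr_fun fun i => ?_)
  rw [ampliation_apply, LinearIsometry.coe_toContinuousLinearMap, T.norm_map]

/-- A closed subspace containing all `e_i ⊗ x` is everything. -/
lemma eq_top_of_incl_mem (M : Submodule ℂ (HilbertSum ι E)) (hM : IsClosed (M : Set (HilbertSum ι E)))
    (h : ∀ i x, incl i x ∈ M) : M = ⊤ := by
  refine (Submodule.eq_top_iff').2 fun x => ?_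
  exact hM.mem_of_tendsto (hasSum_incl x)
    (Filter.Eventually.of_forall fun s => Submodule.sum_mem _ fun i _ => h i _)

end HilbertSum

namespace FockTensor

variable {ι : Type*} {E : Type*} [NormedAddCommGroup E] [InnerProductSpace ℂ E]

lemma creation_nil (i : ι) (x : FockTensor ι E) : creation i x [] = 0 := rfl

lemma creation_cons_self (i : ι) (x : FockTensor ι E) (α : List ι) :
    creation i x (i :: α) = x α :=
  if_pos rfl

lemma creation_cons_ne {i j : ι} (h : j ≠ i) (x : FockTensor ι E) (α : List ι) :
    creation i x (j :: α) = 0 :=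
  if_neg h

lemma creation_incl (i : ι) (α : List ι) (x : E) :
    creation i (HilbertSum.incl α x : FockTensor ι E) = HilbertSum.incl (i :: α) x := by
  refine lp.ext (funext fun β => ?_)
  cases β with
  | nil => rw [creation_nil, HilbertSum.incl_apply_ne (by simp)]
  | cons j β =>
    by_cases hj : j = i
    · subst hj
      rw [creation_cons_self]
      by_cases hβ : β = α
      · subst hβ; rw [HilbertSum.incl_apply_self, HilbertSum.incl_apply_self]
      · rw [HilbertSum.incl_apply_ne hβ, HilbertSum.incl_apply_ne (by simpa using hβ)]
    · rw [creation_cons_ne hj, HilbertSum.incl_apply_ne (by simp [hj])]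

lemma inner_creation_self (i : ι) (x y : FockTensor ι E) :
    inner ℂ (creation i x) (creation i y) = inner ℂ x y := by
  rw [lp.inner_eq_tsum, lp.inner_eq_tsum]
  rw [← (List.cons_injective (a := i)).tsum_eq (f := fun α =>
    inner ℂ ((creation i x : FockTensor ι E) α) ((creation i y : FockTensor ι E) α))]
  · simp only [creation_cons_self]
  · intro α hα
    cases α with
    | nil => simp [creation_nil] at hα
    | cons j α =>
      by_cases hj : j = i
      · subst hj; exact ⟨α, rfl⟩
      · simp [creation_cons_ne hj] at hα

lemma inner_creation_ne {i j : ι} (hij : i ≠ j) (x y : FockTensor ι E) :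
    inner ℂ (creation i x) (creation j y) = 0 := by
  rw [lp.inner_eq_tsum]
  refine (tsum_congr fun α => ?_).trans tsum_zero
  cases α with
  | nil => rw [creation_nil, inner_zero_left]
  | cons k α =>
    by_cases hk : k = i
    · subst hk; rw [creation_cons_ne hij, inner_zero_right]
    · rw [creation_cons_ne hk, inner_zero_left]

end FockTensor

/-! ### Defect operators and the minimal isometric dilation -/

namespace RowContraction

variable {ι : Type*} {H : Type*} [NormedAddCommGroup H] [InnerProductSpace ℂ H] [CompleteSpace H]

instance (T : RowContraction ι H) : CompleteSpace T.defectSpace :=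
  (Submodule.isClosed_topologicalClosure _).completeSpace_coe

lemma defect_defect (T : RowContraction ι H) (x : HilbertSum ι H) :
    T.defect (T.defect x) = x - T.column (T.row x) := by
  have := (positiveSqrt_facts (one_sub_nonneg T.row T.norm_row_le)).2 x
  rw [adjoint_row] at this
  rw [defect, adjoint_row, this]
  rfl

lemma adjoint_defect (T : RowContraction ι H) : adjoint T.defect = T.defect :=
  (positiveSqrt_facts (one_sub_nonneg T.row T.norm_row_le)).1.adjoint_eq

lemma inner_row_left (T : RowContraction ι H) (x : HilbertSum ι H) (h : H) :
    inner ℂ (T.row x) h = inner ℂ x (T.column h) :=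
  adjoint_inner_left _ _ _

lemma inner_defectMap (T : RowContraction ι H) (x y : HilbertSum ι H) :
    inner ℂ (T.defectMap x) (T.defectMap y) = inner ℂ x y - inner ℂ (T.row x) (T.row y) := by
  change inner ℂ (T.defect x) (T.defect y) = _
  rw [← adjoint_inner_right, adjoint_defect, defect_defect, inner_sub_right, inner_row_left]

lemma defectStar_defectStar (T : RowContraction ι H) (h : H) :
    T.defectStar (T.defectStar h) = h - T.row (T.column h) := by
  have := (positiveSqrt_facts T.one_sub_row_nonneg).2 h
  rw [adjoint_row] at this
  rw [defectStar, adjoint_row, this]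
  rfl

/-- `T D = D_* T`. -/
lemma row_defect (T : RowContraction ι H) (x : HilbertSum ι H) :
    T.row (T.defect x) = T.defectStar (T.row x) := by
  have := comp_eq_comp_of_sq_comp (B := T.defect) (C := T.defectStar)
    (CFC.sqrt_nonneg _) (CFC.sqrt_nonneg _) T.row (by
      ext y
      simp only [comp_apply, defect_defect, defectStar_defectStar, map_sub])
  exact congrArg (fun R : HilbertSum ι H →L[ℂ] H => R x) this

lemma denseRange_defectMap (T : RowContraction ι H) : DenseRange T.defectMap :=
  denseRange_codRestrict_topologicalClosure T.defect T.defect_mem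

lemma denseRange_defectStarMap (T : RowContraction ι H) : DenseRange T.defectStarMap :=
  denseRange_codRestrict_topologicalClosure T.defectStar T.defectStar_mem

lemma inclBase_fst (T : RowContraction ι H) (h : H) : (T.inclBase h).fst = h := rfl

lemma inclBase_snd (T : RowContraction ι H) (h : H) : (T.inclBase h).snd = 0 := rfl

lemma inclFock_fst (T : RowContraction ι H) (x : FockTensor ι T.defectSpace) :
    (T.inclFock x).fst = 0 := rfl

lemma inclFock_snd (T : RowContraction ι H) (x : FockTensor ι T.defectSpace) :
    (T.inclFock x).snd = x := rfl

lemma dilation_fst (T : RowContraction ι H) (i : ι) (v : T.DilationSpace) :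
    (T.dilation i v).fst = T.op i v.fst := rfl

lemma dilation_snd (T : RowContraction ι H) (i : ι) (v : T.DilationSpace) :
    (T.dilation i v).snd =
      HilbertSum.incl [] (T.defectMap (HilbertSum.incl i v.fst)) +
        FockTensor.creation i v.snd := rfl

lemma dilationSpace_ext {T : RowContraction ι H} {v w : T.DilationSpace} (h1 : v.fst = w.fst)
    (h2 : v.snd = w.snd) : v = w :=
  WithLp.ofLp_injective 2 (Prod.ext h1 h2)

lemma continuous_inclBase (T : RowContraction ι H) : Continuous T.inclBase :=
  (WithLp.prod_continuous_toLp 2 _ _).comp (Continuous.prodMk continuous_id continuous_const)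

lemma continuous_inclFock (T : RowContraction ι H) : Continuous T.inclFock :=
  (WithLp.prod_continuous_toLp 2 _ _).comp (Continuous.prodMk continuous_const continuous_id)

lemma norm_inclBase (T : RowContraction ι H) (h : H) : ‖T.inclBase h‖ = ‖h‖ := by
  rw [← sq_eq_sq₀ (norm_nonneg _) (norm_nonneg _), WithLp.prod_norm_sq_eq_of_L2]
  simp [inclBase]

lemma norm_inclFock (T : RowContraction ι H) (x : FockTensor ι T.defectSpace) :
    ‖T.inclFock x‖ = ‖x‖ := by
  rw [← sq_eq_sq₀ (norm_nonneg _) (norm_nonneg _), WithLp.prod_norm_sq_eq_of_L2]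
  simp [inclFock]

lemma inner_dilation (T : RowContraction ι H) (i j : ι) (v w : T.DilationSpace) :
    inner ℂ (T.dilation i v) (T.dilation j w) =
      inner ℂ (HilbertSum.incl i v.fst) (HilbertSum.incl j w.fst) +
        inner ℂ (FockTensor.creation i v.snd) (FockTensor.creation j w.snd) := by
  rw [WithLp.prod_inner_apply]
  change inner ℂ (T.dilation i v).fst (T.dilation j w).fst +
    inner ℂ (T.dilation i v).snd (T.dilation j w).snd = _
  rw [dilation_fst, dilation_fst, dilation_snd, dilation_snd, inner_add_left, inner_add_right,
    inner_add_right, HilbertSum.inner_incl_left [], HilbertSum.inner_incl_left [],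
    HilbertSum.inner_incl_right [], HilbertSum.incl_apply_self, inner_defectMap, row_incl,
    row_incl, FockTensor.creation_nil, FockTensor.creation_nil, inner_zero_left, inner_zero_right]
  ring

lemma norm_dilation (T : RowContraction ι H) (i : ι) (v : T.DilationSpace) :
    ‖T.dilation i v‖ = ‖v‖ := by
  refine (LinearMap.norm_map_iff_inner_map_map (T.dilation i)).2 (fun x y => ?_) v
  rw [inner_dilation, HilbertSum.inner_incl_left, HilbertSum.incl_apply_self,
    FockTensor.inner_creation_self, WithLp.prod_inner_apply]
  rfl

lemma isRowEigenvector_inclBase (T : RowContraction ι H) {ω : ι → ℂ} {Ω : H} (hΩ : ‖Ω‖ = 1)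
    (heig : ∀ i, adjoint (T.op i) Ω = (starRingEnd ℂ) (ω i) • Ω) :
    IsRowEigenvector T.dilation ω (T.inclBase Ω) where
  norm_op := T.norm_dilation
  inner_op i j v w hij := by
    rw [inner_dilation, FockTensor.inner_creation_ne hij, HilbertSum.inner_incl_left,
      HilbertSum.incl_apply_ne hij, inner_zero_right, add_zero]
  inner_vec i v := by
    rw [WithLp.prod_inner_apply, WithLp.prod_inner_apply]
    change inner ℂ Ω (T.op i v.fst) + inner ℂ (0 : FockTensor ι T.defectSpace) (T.dilation i v).snd
      = ω i * (inner ℂ Ω v.fst + inner ℂ (0 : FockTensor ι T.defectSpace) v.snd)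
    rw [inner_zero_left, inner_zero_left, ← adjoint_inner_left, heig, inner_smul_left]
    simp
  norm_vec := by rw [norm_inclBase, hΩ]

/-- Minimality of the dilation: `H` generates the dilation space. -/
lemma eq_top_of_invariant (T : RowContraction ι H) (M : Submodule ℂ T.DilationSpace)
    (hM : IsClosed (M : Set T.DilationSpace)) (hH : ∀ h, T.inclBase h ∈ M)
    (hinv : ∀ i, ∀ v ∈ M, T.dilation i v ∈ M) : M = ⊤ := by
  have h0 : ∀ x, T.inclFock (HilbertSum.incl [] (T.defectMap x)) ∈ M := by
    have htop : M.comap (T.inclFock ∘ₗ (HilbertSum.incl []).toLinearMap ∘ₗ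
        T.defectMap.toLinearMap) = ⊤ := by
      refine HilbertSum.eq_top_of_incl_mem _ (hM.preimage (T.continuous_inclFock.comp
        ((HilbertSum.incl []).continuous.comp T.defectMap.continuous))) fun i h => ?_
      rw [Submodule.mem_comap]
      convert! M.sub_mem (hinv i _ (hH h)) (hH (T.op i h)) using 1
      refine dilationSpace_ext ?_ ?_
      · simp [inclFock_fst, inclBase_fst, dilation_fst]
      · simp [inclFock_snd, inclBase_fst, inclBase_snd, dilation_snd]
    exact fun x => (Submodule.eq_top_iff'.1 htop x :)
  have h1 : ∀ f : T.defectSpace, T.inclFock (HilbertSum.incl [] f) ∈ M := by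
    have hcl : IsClosed {f : T.defectSpace | T.inclFock (HilbertSum.incl [] f) ∈ M} :=
      hM.preimage (T.continuous_inclFock.comp (HilbertSum.incl []).continuous)
    exact fun f => T.denseRange_defectMap.induction_on f hcl h0
  have h2 : ∀ (α : List ι) (f : T.defectSpace), T.inclFock (HilbertSum.incl α f) ∈ M := by
    intro α f
    induction α with
    | nil => exact h1 f
    | cons i α ih =>
      convert! hinv i _ ih using 1
      refine dilationSpace_ext ?_ ?_
      · simp [inclFock_fst, dilation_fst]
      · simp [inclFock_snd, inclFock_fst, dilation_snd, FockTensor.creation_incl]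
  have h3 : M.comap T.inclFock = ⊤ :=
    HilbertSum.eq_top_of_incl_mem _ (hM.preimage T.continuous_inclFock) h2
  refine Submodule.eq_top_iff'.2 fun v => ?_
  convert! M.add_mem (hH v.fst) (Submodule.eq_top_iff'.1 h3 v.snd :) using 1
  refine dilationSpace_ext ?_ ?_ <;> simp [inclFock_fst, inclFock_snd, inclBase_fst, inclBase_snd]

/-- A cyclic-vector criterion: if the closed span of the orbit of `Ω` contains `H`, it is the whole
dilation space. -/
lemma orbit_dense_of_base_mem (T : RowContraction ι H) (Ω : H)
    (hH : ∀ h, T.inclBase h ∈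
      (Submodule.span ℂ (Set.range (orbit T.dilation (T.inclBase Ω)))).topologicalClosure) :
    (Submodule.span ℂ (Set.range (orbit T.dilation (T.inclBase Ω)))).topologicalClosure = ⊤ := by
  refine T.eq_top_of_invariant _ (Submodule.isClosed_topologicalClosure _) hH fun i => ?_
  set M := Submodule.span ℂ (Set.range (orbit T.dilation (T.inclBase Ω)))
  have : M.topologicalClosure ≤ M.topologicalClosure.comap (T.dilation i) := by
    refine Submodule.topologicalClosure_minimal _ (Submodule.span_le.2 ?_)
      (M.isClosed_topologicalClosure.preimage
        (LinearIsometry.mk (T.dilation i) (T.norm_dilation i)).continuous)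
    rintro _ ⟨α, rfl⟩
    exact M.le_topologicalClosure (Submodule.subset_span ⟨i :: α, rfl⟩)
  exact fun v hv => this hv

lemma IsCoisometric.row_column {T : RowContraction ι H} (hT : T.IsCoisometric) (h : H) :
    T.row (T.column h) = h := by
  refine (((HilbertSum.hasSum_incl (T.column h)).mapL T.row).unique ?_)
  simpa only [row_incl, column_apply] using hT h

lemma IsCoisometric.defect_column {T : RowContraction ι H} (hT : T.IsCoisometric) (h : H) :
    T.defectMap (T.column h) = 0 := by
  rw [← inner_self_eq_zero (𝕜 := ℂ), inner_defectMap, ← inner_row_left, hT.row_column, sub_self]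

/-- The dilation of a coisometric tuple is again coisometric, and `V_i^*` extends `A_i^*`; on
vectors of `H` this says `h = ∑ V_i A_i^* h`. -/
lemma IsCoisometric.hasSum_dilation {T : RowContraction ι H} (hT : T.IsCoisometric) (h : H) :
    HasSum (fun i => T.dilation i (T.inclBase (adjoint (T.op i) h))) (T.inclBase h) := by
  have h1 : HasSum (fun i => T.inclBase (T.op i (adjoint (T.op i) h))) (T.inclBase h) :=
    (hT h).map T.inclBase T.continuous_inclBase
  have h2 := ((HilbertSum.hasSum_incl (T.column h)).mapL T.defectMap).map
    (T.inclFock ∘ₗ (HilbertSum.incl []).toLinearMap)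
    (T.continuous_inclFock.comp (HilbertSum.incl []).continuous)
  rw [hT.defect_column, map_zero] at h2
  have h3 := h1.add h2
  rw [add_zero] at h3
  refine h3.congr_fun fun i => ?_
  refine dilationSpace_ext ?_ ?_ <;>
    simp [inclFock_fst, inclFock_snd, inclBase_fst, inclBase_snd, dilation_fst, dilation_snd,
      column_apply]

/-- Ergodicity makes `Ω` cyclic for the dilation: the compression to `H` of the projection onto the
closed span of the orbit of `Ω` is a fixed point of `Z(X) = ∑ A_i X A_i^*` that fixes `Ω`. -/
lemma orbit_dense_of_isErgodic {A : RowContraction ι H} (hA : A.IsCoisometric) (herg : A.IsErgodic)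
    {ω : ι → ℂ} {Ω : H} (hΩ : ‖Ω‖ = 1)
    (heig : ∀ i, adjoint (A.op i) Ω = (starRingEnd ℂ) (ω i) • Ω) :
    (Submodule.span ℂ (Set.range (orbit A.dilation (A.inclBase Ω)))).topologicalClosure = ⊤ := by
  refine A.orbit_dense_of_base_mem Ω ?_
  have hV := A.isRowEigenvector_inclBase hΩ heig
  have hcomm := hV.starProjection_op
  have hΩM : A.inclBase Ω ∈
      (Submodule.span ℂ (Set.range (orbit A.dilation (A.inclBase Ω)))).topologicalClosure :=
    Submodule.le_topologicalClosure _ (Submodule.subset_span ⟨[], rfl⟩)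
  set M := (Submodule.span ℂ (Set.range (orbit A.dilation (A.inclBase Ω)))).topologicalClosure
  let J : H →L[ℂ] A.DilationSpace := ⟨A.inclBase, A.continuous_inclBase⟩
  let X : H →L[ℂ] H := WithLp.fstL 2 ℂ _ _ ∘L M.starProjection ∘L J
  have hX : ∀ h, X h = (M.starProjection (A.inclBase h)).fst := fun h => rfl
  obtain ⟨c, hc⟩ := herg X fun h => by
    have := ((hA.hasSum_dilation h).mapL M.starProjection).mapL
      (WithLp.fstL 2 ℂ H (FockTensor ι A.defectSpace))
    refine this.congr_fun fun i => ?_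
    change A.op i (M.starProjection (A.inclBase (adjoint (A.op i) h))).fst =
      (M.starProjection (A.dilation i (A.inclBase (adjoint (A.op i) h)))).fst
    rw [hcomm, dilation_fst]
  have hXΩ : X Ω = Ω := by rw [hX, Submodule.starProjection_eq_self_iff.2 hΩM, inclBase_fst]
  have hc1 : c = 1 := by
    have hΩ0 : Ω ≠ 0 := fun h => by simp [h] at hΩ
    rw [hc] at hXΩ
    exact smul_left_injective ℂ hΩ0 (by simpa using hXΩ)
  intro h
  have hfst : (M.starProjection (A.inclBase h)).fst = h := by
    rw [← hX, hc, hc1]; simp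
  -- a projection that does not change the `H`-component of `h ∈ H` fixes `h`
  have hn : ‖M.starProjection (A.inclBase h)‖ ^ 2 ≤ ‖A.inclBase h‖ ^ 2 :=
    pow_le_pow_left₀ (norm_nonneg _) (M.norm_starProjection_apply_le _) 2
  rw [WithLp.prod_norm_sq_eq_of_L2, WithLp.prod_norm_sq_eq_of_L2] at hn
  change ‖(M.starProjection (A.inclBase h)).fst‖ ^ 2 + ‖(M.starProjection (A.inclBase h)).snd‖ ^ 2
    ≤ ‖h‖ ^ 2 + ‖(0 : FockTensor ι A.defectSpace)‖ ^ 2 at hn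
  rw [hfst, norm_zero] at hn
  have hsnd : (M.starProjection (A.inclBase h)).snd = 0 := by
    have : ‖(M.starProjection (A.inclBase h)).snd‖ ^ 2 = 0 :=
      le_antisymm (by linarith) (sq_nonneg _)
    simpa using this
  exact Submodule.starProjection_eq_self_iff.1 (dilationSpace_ext hfst hsnd)

end RowContraction

/-! ### The Poisson kernel, `*`-stability and the characteristic function -/

namespace HilbertSum

lemma tsum_enorm_sq {ι : Type*} {E : Type*} [NormedAddCommGroup E] [InnerProductSpace ℂ E]
    (x : HilbertSum ι E) : ∑' i, ‖x i‖ₑ ^ 2 = ‖x‖ₑ ^ 2 := by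
  simp only [← ofReal_norm, ← ENNReal.ofReal_pow (norm_nonneg _)]
  rw [← ENNReal.ofReal_tsum_of_nonneg (fun _ => sq_nonneg _) (norm_sq_eq x).summable,
    (norm_sq_eq x).tsum_eq]

end HilbertSum

lemma ENNReal.tsum_list {ι : Type*} (f : List ι → ℝ≥0∞) :
    ∑' α, f α = f [] + ∑' i, ∑' β, f (i :: β) := by
  have hinj : Function.Injective fun p : ι × List ι => p.1 :: p.2 := fun p q h =>
    Prod.ext (List.cons.inj h).1 (List.cons.inj h).2
  have hcompl : ({[]}ᶜ : Set (List ι)) = Set.range fun p : ι × List ι => p.1 :: p.2 := by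
    ext α
    cases α <;> simp
  rw [← ENNReal.summable.tsum_add_tsum_compl (s := {[]}) ENNReal.summable, tsum_singleton, hcompl,
    tsum_range f hinj, ENNReal.tsum_prod']

namespace RowContraction

variable {ι : Type*} {H : Type*} [NormedAddCommGroup H] [InnerProductSpace ℂ H] [CompleteSpace H]

section StarStability

lemma adjoint_word_nil (T : RowContraction ι H) (h : H) : adjoint (T.word []) h = h := by
  have h1 : adjoint (T.word []) = 1 := by simp [word, ← star_eq_adjoint]
  rw [h1, one_apply_eq_self]

lemma enorm_defectStar_sq_add (T : RowContraction ι H) (h : H) :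
    ‖T.defectStarMap h‖ₑ ^ 2 + ∑' i, ‖adjoint (T.op i) h‖ₑ ^ 2 = ‖h‖ₑ ^ 2 := by
  rw [show ∑' i, ‖adjoint (T.op i) h‖ₑ ^ 2 = ‖T.column h‖ₑ ^ 2 from
    HilbertSum.tsum_enorm_sq (T.column h)]
  change ‖T.defectStar h‖ₑ ^ 2 + _ = _
  simp only [← ofReal_norm, ← ENNReal.ofReal_pow (norm_nonneg _)]
  rw [← ENNReal.ofReal_add (sq_nonneg _) (sq_nonneg _), norm_defectStar_sq, sub_add_cancel]

/-- Iterating `‖h‖² = ‖D_* h‖² + ∑_i ‖T_i^* h‖²`. -/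
lemma tsum_word_add_tsum_defect (T : RowContraction ι H) (n : ℕ) (h : H) :
    ∑' α : List ι, (if α.length = n then ‖adjoint (T.word α) h‖ₑ ^ 2 else 0) +
      ∑' α : List ι, (if α.length < n then ‖T.poissonKernel h α‖ₑ ^ 2 else 0) = ‖h‖ₑ ^ 2 := by
  change _ + ∑' α : List ι,
    (if α.length < n then ‖T.defectStarMap (adjoint (T.word α) h)‖ₑ ^ 2 else 0) = _
  induction n generalizing h with
  | zero =>
    rw [ENNReal.tsum_list]
    simp [adjoint_word_nil]
  | succ n ih =>
    rw [ENNReal.tsum_list, ENNReal.tsum_list]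
    simp only [List.length_cons, List.length_nil, Nat.add_right_cancel_iff,
      Nat.add_lt_add_iff_right, adjoint_word_cons, adjoint_word_nil]
    rw [if_neg (by simp), if_pos (by simp), zero_add, add_left_comm, ← ENNReal.tsum_add]
    simp only [ih]
    exact T.enorm_defectStar_sq_add h

/-- A row contraction is `*`-stable as soon as its Poisson kernel is isometric: then
`∑_{|α| = n} ‖T_α^* h‖²` is the tail `|α| ≥ n` of the series `∑_α ‖D_* T_α^* h‖² = ‖h‖²`. -/
lemma isStarStable_of_norm_poissonKernel (T : RowContraction ι H)
    (hT : ∀ h, ‖T.poissonKernel h‖ = ‖h‖) : T.IsStarStable := by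
  intro h
  have hsum : ∑' α, ‖T.poissonKernel h α‖ₑ ^ 2 = ‖h‖ₑ ^ 2 := by
    rw [HilbertSum.tsum_enorm_sq, ← ofReal_norm, hT, ofReal_norm]
  have hfin : ∑' α, ‖T.poissonKernel h α‖ₑ ^ 2 ≠ ∞ := by simp [hsum]
  have htail : ∀ n : ℕ, ∑' α : {α : List ι // α.length = n}, ‖adjoint (T.word α) h‖ₑ ^ 2 =
      ∑' α : List ι, if α.length < n then 0 else ‖T.poissonKernel h α‖ₑ ^ 2 := by
    intro n
    have h1 := T.tsum_word_add_tsum_defect n h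
    have h2 : ∑' α : {α : List ι // α.length = n}, ‖adjoint (T.word α) h‖ₑ ^ 2 =
        ∑' α : List ι, (if α.length = n then ‖adjoint (T.word α) h‖ₑ ^ 2 else 0) := by
      refine (tsum_subtype {α : List ι | α.length = n} fun α => ‖adjoint (T.word α) h‖ₑ ^ 2).trans
        (tsum_congr fun α => ?_)
      simp [Set.indicator_apply]
    have h3 : (∑' α : List ι, if α.length < n then 0 else ‖T.poissonKernel h α‖ₑ ^ 2) +
        ∑' α : List ι, (if α.length < n then ‖T.poissonKernel h α‖ₑ ^ 2 else 0) = ‖h‖ₑ ^ 2 := by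
      rw [← ENNReal.tsum_add, ← hsum]
      refine tsum_congr fun α => ?_
      split_ifs <;> simp
    have h4 : ∑' α : List ι, (if α.length < n then ‖T.poissonKernel h α‖ₑ ^ 2 else 0) ≠ ∞ := by
      refine ne_top_of_le_ne_top hfin (ENNReal.tsum_le_tsum fun α => ?_)
      split_ifs <;> simp
    rw [h2]
    exact (ENNReal.add_left_inj h4).1 (h1.trans h3.symm)
  simp only [htail]
  rw [ENNReal.tendsto_nhds_zero]
  intro ε hε
  obtain ⟨s, hs⟩ := (ENNReal.tendsto_nhds_zero.1
    (ENNReal.tendsto_tsum_compl_atTop_zero hfin) ε hε).exists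
  refine Filter.eventually_atTop.2 ⟨s.sup List.length + 1, fun n hn => le_trans ?_ hs⟩
  refine le_trans (ENNReal.tsum_le_tsum fun α => ?_)
    (tsum_subtype {α : List ι | α ∉ s} fun α => ‖T.poissonKernel h α‖ₑ ^ 2).ge
  by_cases hα : α ∈ s
  · have : α.length < n := (Nat.lt_succ_of_le (Finset.le_sup (f := List.length) hα)).trans_le hn
    simp [this]
  · rw [Set.indicator_of_mem (show α ∈ {α : List ι | α ∉ s} from hα)]
    split_ifs <;> simp

end StarStability

/-- `θ_T (D h^{(i)}) = e_i ⊗ C h - C T_i h`, which rests on `T D = D_* T`. -/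
lemma charFun_defectMap_incl (T : RowContraction ι H) (i : ι) (h : H) :
    T.charFun (T.defectMap (HilbertSum.incl i h)) =
      FockTensor.creation i (T.poissonKernel h) - T.poissonKernel (T.op i h) := by
  refine lp.ext (funext fun α => ?_)
  rw [lp.coeFn_sub, Pi.sub_apply]
  change T.charFunCoord _ α = _ - T.defectStarMap (adjoint (T.word α) (T.op i h))
  cases α with
  | nil =>
    rw [FockTensor.creation_nil, adjoint_word_nil, zero_sub]
    refine congrArg Neg.neg (Subtype.ext ?_)
    change T.row (T.defect _) = T.defectStar _
    rw [row_defect, row_incl]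
  | cons j α =>
    change T.defectStarMap (adjoint (T.word α) (T.defect (T.defect (HilbertSum.incl i h)) j)) = _
    rw [defect_defect, row_incl, lp.coeFn_sub, Pi.sub_apply, column_apply, map_sub, map_sub,
      adjoint_word_cons]
    congr 1
    by_cases hj : j = i
    · subst hj
      rw [FockTensor.creation_cons_self, HilbertSum.incl_apply_self]
      rfl
    · rw [FockTensor.creation_cons_ne hj, HilbertSum.incl_apply_ne hj, map_zero, map_zero]

/-- For a coisometric tuple `1 - T^* T` is a projection, so `D` is that projection. -/
lemma IsCoisometric.defect_apply {T : RowContraction ι H} (hT : T.IsCoisometric)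
    (x : HilbertSum ι H) : T.defect x = x - T.column (T.row x) := by
  have h0 := one_sub_nonneg T.row T.norm_row_le
  rw [defect, positiveSqrt_eq_self h0 ?_]
  · rw [adjoint_row]; rfl
  · ext1 y
    rw [adjoint_row]
    change y - T.column (T.row y) - T.column (T.row (y - T.column (T.row y))) =
      y - T.column (T.row y)
    rw [map_sub, hT.row_column, sub_self, map_zero, sub_zero]

lemma IsCoisometric.norm_column {T : RowContraction ι H} (hT : T.IsCoisometric) (h : H) :
    ‖T.column h‖ = ‖h‖ := by
  rw [← sq_eq_sq₀ (norm_nonneg _) (norm_nonneg _), ← inner_self_eq_norm_sq (𝕜 := ℂ),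
    ← inner_row_left, hT.row_column, inner_self_eq_norm_sq]

/-! ### Tuples of scalars -/

section Scalar

variable (ω : ι → ℂ) (hω : HasSum (fun i => ‖ω i‖ ^ 2) 1)

lemma adjoint_scalar_op (i : ι) (z : ℂ) :
    adjoint ((scalar ω hω).op i) z = (starRingEnd ℂ) (ω i) * z := by
  refine ext_inner_left ℂ fun w => ?_
  rw [adjoint_inner_right]
  change inner ℂ (ω i • w) z = _
  rw [inner_smul_left]
  exact (inner_smul_right w z _).symm

lemma isCoisometric_scalar : (scalar ω hω).IsCoisometric := by
  intro z
  have h := ((Complex.hasSum_ofReal.2 hω).mul_right z)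
  rw [Complex.ofReal_one, one_mul] at h
  refine h.congr_fun fun i => ?_
  rw [adjoint_scalar_op]
  change ω i * ((starRingEnd ℂ) (ω i) * z) = _
  rw [← mul_assoc, Complex.mul_conj']
  simp

/-- The vector `1 ∈ ℂ` is cyclic for the dilation of a tuple of scalars. -/
lemma orbit_dense_scalar :
    (Submodule.span ℂ (Set.range
      (orbit (scalar ω hω).dilation ((scalar ω hω).inclBase 1)))).topologicalClosure = ⊤ := by
  refine (scalar ω hω).orbit_dense_of_base_mem 1 fun z => ?_
  rw [← mul_one z, ← smul_eq_mul, map_smul]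
  exact Submodule.smul_mem _ _
    (Submodule.le_topologicalClosure _ (Submodule.subset_span ⟨[], rfl⟩))

end Scalar

/-! ### The compression to the complement of the invariant vector -/

section Reduced

variable {A : RowContraction ι H} {Ω : H}

lemma adjoint_reduced_op (A : RowContraction ι H) (Ω : H) (i : ι) (h : (ℂ ∙ Ω)ᗮ) :
    adjoint ((A.reduced Ω).op i) h =
      (ℂ ∙ Ω)ᗮ.orthogonalProjectionOnto (adjoint (A.op i) (h : H)) := by
  change adjoint ((ℂ ∙ Ω)ᗮ.orthogonalProjectionOnto ∘L A.op i ∘L (ℂ ∙ Ω)ᗮ.subtypeL) h = _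
  rw [adjoint_comp, adjoint_comp, Submodule.adjoint_subtypeL,
    Submodule.adjoint_orthogonalProjectionOnto]
  rfl

/-- Splitting `A_i^* h` along `H = ℂ Ω ⊕ H°`. -/
lemma adjoint_op_eq (hΩ : ‖Ω‖ = 1) (i : ι) (h : (ℂ ∙ Ω)ᗮ) :
    adjoint (A.op i) (h : H) =
      A.hatDefectStar Ω h i • Ω + (adjoint ((A.reduced Ω).op i) h : H) := by
  rw [adjoint_reduced_op, hatDefectStar_apply, ← Submodule.starProjection_unit_singleton ℂ hΩ]
  change _ = _ + (ℂ ∙ Ω)ᗮ.starProjection _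
  rw [Submodule.starProjection_orthogonal_val]
  abel

lemma reduced_op_coe {ω : ι → ℂ}
    (heig : ∀ i, adjoint (A.op i) Ω = (starRingEnd ℂ) (ω i) • Ω) (i : ι) (h : (ℂ ∙ Ω)ᗮ) :
    ((A.reduced Ω).op i h : H) = A.op i h := by
  change (ℂ ∙ Ω)ᗮ.starProjection (A.op i h) = _
  rw [Submodule.starProjection_eq_self_iff, Submodule.mem_orthogonal_singleton_iff_inner_right,
    ← adjoint_inner_left, heig, inner_smul_left,
    Submodule.mem_orthogonal_singleton_iff_inner_right.1 h.2, mul_zero]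

lemma norm_column_sq (hΩ : ‖Ω‖ = 1) (h : (ℂ ∙ Ω)ᗮ) :
    ‖A.column h‖ ^ 2 = ‖A.hatDefectStar Ω h‖ ^ 2 + ‖(A.reduced Ω).column h‖ ^ 2 := by
  refine (HilbertSum.norm_sq_eq (A.column h)).unique
    (((HilbertSum.norm_sq_eq (A.hatDefectStar Ω h)).add
      (HilbertSum.norm_sq_eq ((A.reduced Ω).column h))).congr_fun fun i => ?_)
  rw [column_apply, column_apply, adjoint_op_eq hΩ, sq, sq, sq,
    norm_add_sq_eq_norm_sq_add_norm_sq_of_inner_eq_zero (𝕜 := ℂ), norm_smul, hΩ, mul_one]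
  · rfl
  · rw [inner_smul_left, Submodule.mem_orthogonal_singleton_iff_inner_right.1
      (adjoint ((A.reduced Ω).op i) h).2, mul_zero]

lemma norm_defectStarMap_reduced (hA : A.IsCoisometric) (hΩ : ‖Ω‖ = 1) (h : (ℂ ∙ Ω)ᗮ) :
    ‖(A.reduced Ω).defectStarMap h‖ = ‖A.hatDefectStar Ω h‖ := by
  rw [← sq_eq_sq₀ (norm_nonneg _) (norm_nonneg _)]
  change ‖(A.reduced Ω).defectStar h‖ ^ 2 = _
  have h1 := norm_column_sq (A := A) hΩ h
  rw [hA.norm_column] at h1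
  rw [norm_defectStar_sq]
  change ‖(h : H)‖ ^ 2 - _ = _
  rw [h1, add_sub_cancel_right]

variable {ω : ι → ℂ} (hω : HasSum (fun i => ‖ω i‖ ^ 2) 1)

/-- `D̂_* h` is orthogonal to `(\bar ω_i)_i`, that is, it lies in `𝒟_ω`. -/
lemma row_scalar_hatDefectStar (hA : A.IsCoisometric)
    (heig : ∀ i, adjoint (A.op i) Ω = (starRingEnd ℂ) (ω i) • Ω) (h : (ℂ ∙ Ω)ᗮ) :
    (scalar ω hω).row (A.hatDefectStar Ω h) = 0 := by
  have h1 : inner ℂ (A.column Ω) (A.column h) = 0 := by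
    rw [← inner_row_left, hA.row_column, Submodule.mem_orthogonal_singleton_iff_inner_right.1 h.2]
  have h2 : inner ℂ ((scalar ω hω).column 1) (A.hatDefectStar Ω h) =
      inner ℂ (A.column Ω) (A.column h) := by
    rw [lp.inner_eq_tsum, lp.inner_eq_tsum]
    refine tsum_congr fun i => ?_
    rw [column_apply, column_apply, column_apply, adjoint_scalar_op, heig, inner_smul_left,
      hatDefectStar_apply, mul_one]
    simp [mul_comm]
  rw [h1, ← inner_conj_symm, ← inner_row_left, inner_conj_symm] at h2
  simpa using h2

/-- `D̂_*` as an operator `H° → 𝒟_ω`. -/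
def hatDefectStarMap (A : RowContraction ι H) (Ω : H) : (ℂ ∙ Ω)ᗮ →L[ℂ] (scalar ω hω).defectSpace :=
  (scalar ω hω).defectMap ∘L A.hatDefectStar Ω

lemma hatDefectStarMap_coe (hA : A.IsCoisometric)
    (heig : ∀ i, adjoint (A.op i) Ω = (starRingEnd ℂ) (ω i) • Ω) (h : (ℂ ∙ Ω)ᗮ) :
    (A.hatDefectStarMap hω Ω h : HilbertSum ι ℂ) = A.hatDefectStar Ω h := by
  change (scalar ω hω).defect (A.hatDefectStar Ω h) = _
  rw [(isCoisometric_scalar ω hω).defect_apply, row_scalar_hatDefectStar hω hA heig, map_zero,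
    sub_zero]

/-- The isometry `γ : 𝒟_{*,Å} → 𝒟_ω` with `γ D̊_* = D̂_*`, obtained from
`‖D̊_* h‖ = ‖D̂_* h‖` by extension to the closure. -/
lemma exists_isometry_defectStarSpace (hA : A.IsCoisometric) (hΩ : ‖Ω‖ = 1)
    (heig : ∀ i, adjoint (A.op i) Ω = (starRingEnd ℂ) (ω i) • Ω) :
    ∃ γ : (A.reduced Ω).defectStarSpace →ₗᵢ[ℂ] (scalar ω hω).defectSpace,
      ∀ h, γ ((A.reduced Ω).defectStarMap h) = A.hatDefectStarMap hω Ω h := by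
  have hd := (A.reduced Ω).denseRange_defectStarMap
  have hn : ∀ h, ‖A.hatDefectStarMap hω Ω h‖ = ‖(A.reduced Ω).defectStarMap h‖ := fun h => by
    rw [norm_defectStarMap_reduced hA hΩ, ← hatDefectStarMap_coe hω hA heig, Submodule.coe_norm]
  let g := (A.hatDefectStarMap hω Ω).toLinearMap.extendOfNorm
    (A.reduced Ω).defectStarMap.toLinearMap
  have hg : ∀ h, g ((A.reduced Ω).defectStarMap h) = A.hatDefectStarMap hω Ω h := fun h =>
    LinearMap.extendOfNorm_eq hd ⟨1, fun x => by simpa using (hn x).le⟩ h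
  refine ⟨⟨g.toLinearMap, fun x => ?_⟩, hg⟩
  refine hd.induction_on x (isClosed_eq (g.continuous.norm) continuous_norm) fun h => ?_
  exact (congrArg norm (hg h)).trans (hn h)

end Reduced

/-! ### The intertwining unitary and the extended characteristic function -/

section Intertwiner

variable {A : RowContraction ι H} {Ω : H} {ω : ι → ℂ} {hω : HasSum (fun i => ‖ω i‖ ^ 2) 1}
  {W : A.DilationSpace ≃ₗᵢ[ℂ] (scalar ω hω).DilationSpace}

namespace IsDilationIntertwiner

/-- As `W Ω = 1`, the `ℂ`-component of `W v` is `⟨Ω, v⟩`. -/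
lemma fst_eq (hW : A.IsDilationIntertwiner (scalar ω hω) Ω 1 W) (v : A.DilationSpace) :
    (W v).fst = inner ℂ Ω v.fst := by
  have h := W.inner_map_map (A.inclBase Ω) v
  rw [show W (A.inclBase Ω) = (scalar ω hω).inclBase 1 from hW.map_vector,
    WithLp.prod_inner_apply, WithLp.prod_inner_apply] at h
  change inner ℂ (1 : ℂ) (W v).fst + inner ℂ (0 : FockTensor ι _) (W v).snd =
    inner ℂ Ω v.fst + inner ℂ (0 : FockTensor ι _) v.snd at h
  rw [inner_zero_left, inner_zero_left] at h
  simpa using h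

/-- The coordinate of `W h` at the word `α` is `D̂_* Å_α^* h`, by recursion on `α` from
`W h = ∑ V_i^ω W A_i^* h`. -/
lemma snd_apply (hW : A.IsDilationIntertwiner (scalar ω hω) Ω 1 W) (hA : A.IsCoisometric)
    (hΩ : ‖Ω‖ = 1) (α : List ι) (h : (ℂ ∙ Ω)ᗮ) :
    (W (A.inclBase h)).snd α =
      A.hatDefectStarMap hω Ω (adjoint ((A.reduced Ω).word α) h) := by
  have hs : ∀ (h : (ℂ ∙ Ω)ᗮ) (α : List ι), HasSum (fun i => ((scalar ω hω).dilation i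
      (W (A.inclBase (adjoint (A.op i) h)))).snd α) ((W (A.inclBase h)).snd α) := by
    intro h α
    have h1 := ((hA.hasSum_dilation (h : H)).map W.toLinearEquiv.toLinearMap W.continuous).mapL
      (lp.evalCLM ℂ (fun _ : List ι => (scalar ω hω).defectSpace) 2 α ∘L
        WithLp.sndL 2 ℂ ℂ (FockTensor ι (scalar ω hω).defectSpace))
    refine h1.congr_fun fun i => ?_
    rw [← hW.intertwines]
    rfl
  induction α generalizing h with
  | nil =>
    rw [adjoint_word_nil]
    refine (hs h []).unique ?_
    refine ((HilbertSum.hasSum_incl (A.hatDefectStar Ω h)).mapL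
      (scalar ω hω).defectMap).congr_fun fun i => ?_
    rw [dilation_snd, lp.coeFn_add, Pi.add_apply, FockTensor.creation_nil,
      HilbertSum.incl_apply_self, add_zero, hW.fst_eq]
    rfl
  | cons j α ih =>
    rw [adjoint_word_cons]
    have h2 : (W (A.inclBase (adjoint (A.op j) h))).snd α =
        (W (A.inclBase (adjoint ((A.reduced Ω).op j) h : (ℂ ∙ Ω)ᗮ))).snd α := by
      rw [adjoint_op_eq hΩ, map_add, map_smul, map_add, map_smul,
        show W (A.inclBase Ω) = (scalar ω hω).inclBase 1 from hW.map_vector, WithLp.add_snd,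
        WithLp.smul_snd, inclBase_snd, smul_zero, zero_add]
    rw [← ih, ← h2]
    have h3 := (hs h (j :: α)).unique (hasSum_single j fun i hij => by
      rw [dilation_snd, lp.coeFn_add, Pi.add_apply, HilbertSum.incl_apply_ne (by simp), zero_add,
        FockTensor.creation_cons_ne hij.symm])
    rw [h3, dilation_snd, lp.coeFn_add, Pi.add_apply, HilbertSum.incl_apply_ne (by simp), zero_add,
      FockTensor.creation_cons_self]

/-- `Ĉ = (1 ⊗ γ) C̊` on `H°`. -/
lemma inclFock_poissonKernel (hW : A.IsDilationIntertwiner (scalar ω hω) Ω 1 W)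
    (hA : A.IsCoisometric) (hΩ : ‖Ω‖ = 1)
    {γ : (A.reduced Ω).defectStarSpace →ₗᵢ[ℂ] (scalar ω hω).defectSpace}
    (hγ : ∀ h, γ ((A.reduced Ω).defectStarMap h) = A.hatDefectStarMap hω Ω h) (h : (ℂ ∙ Ω)ᗮ) :
    (scalar ω hω).inclFock
      (HilbertSum.ampliation γ.toContinuousLinearMap ((A.reduced Ω).poissonKernel h)) =
      W (A.inclBase h) := by
  refine dilationSpace_ext ?_ (lp.ext (funext fun α => ?_))
  · rw [hW.fst_eq, inclBase_fst, inclFock_fst,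
      Submodule.mem_orthogonal_singleton_iff_inner_right.1 h.2]
  · rw [hW.snd_apply hA hΩ, inclFock_snd, HilbertSum.ampliation_apply, ← hγ]
    rfl

/-- `θ̂ D h^{(i)} = W V_i h - W A_i h = V_i^ω Ĉ h - Ĉ A_i h`, which is `1 ⊗ γ` applied to
`e_i ⊗ C̊ h - C̊ Å_i h`. -/
lemma inclFock_charFun (hW : A.IsDilationIntertwiner (scalar ω hω) Ω 1 W)
    (hA : A.IsCoisometric) (hΩ : ‖Ω‖ = 1)
    (heig : ∀ i, adjoint (A.op i) Ω = (starRingEnd ℂ) (ω i) • Ω)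
    {γ : (A.reduced Ω).defectStarSpace →ₗᵢ[ℂ] (scalar ω hω).defectSpace}
    (hγ : ∀ h, γ ((A.reduced Ω).defectStarMap h) = A.hatDefectStarMap hω Ω h) (i : ι)
    (h : (ℂ ∙ Ω)ᗮ) :
    (scalar ω hω).inclFock (HilbertSum.ampliation γ.toContinuousLinearMap
      ((A.reduced Ω).charFun ((A.reduced Ω).defectMap (HilbertSum.incl i h)))) =
      extendedCharFun W (A.defectMap (HilbertSum.incl i (h : H))) := by
  have hV : A.inclFock (HilbertSum.incl [] (A.defectMap (HilbertSum.incl i (h : H)))) =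
      A.dilation i (A.inclBase h) - A.inclBase (A.op i h) := by
    refine dilationSpace_ext ?_ ?_
    · simp [inclFock_fst, inclBase_fst, dilation_fst]
    · simp [inclFock_snd, inclBase_fst, inclBase_snd, dilation_snd]
  change _ = W (A.inclFock (HilbertSum.incl [] (A.defectMap (HilbertSum.incl i (h : H)))))
  rw [hV, map_sub, hW.intertwines, ← reduced_op_coe heig,
    ← hW.inclFock_poissonKernel hA hΩ hγ, ← hW.inclFock_poissonKernel hA hΩ hγ,
    charFun_defectMap_incl, map_sub, map_sub]
  congr 1
  refine dilationSpace_ext ?_ ?_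
  · rw [inclFock_fst, dilation_fst, inclFock_fst, map_zero]
  · rw [inclFock_snd, dilation_snd, inclFock_fst, inclFock_snd, map_zero, map_zero, map_zero,
      zero_add]
    refine lp.ext (funext fun α => ?_)
    cases α with
    | nil => rw [HilbertSum.ampliation_apply, FockTensor.creation_nil, FockTensor.creation_nil,
        map_zero]
    | cons j α =>
      rw [HilbertSum.ampliation_apply]
      by_cases hj : j = i
      · subst hj
        rw [FockTensor.creation_cons_self, FockTensor.creation_cons_self,
          HilbertSum.ampliation_apply]
      · rw [FockTensor.creation_cons_ne hj, FockTensor.creation_cons_ne hj, map_zero]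

end IsDilationIntertwiner

end Intertwiner

end RowContraction
end

theorem theorem3p5p2 {ι : Type*} [Countable ι] [Nontrivial ι]
    {H : Type*} [NormedAddCommGroup H] [InnerProductSpace ℂ H] [CompleteSpace H]
    (A : RowContraction ι H) (hcoisom : A.IsCoisometric) (herg : A.IsErgodic)
    (Ω : H) (hΩ : ‖Ω‖ = 1) (ω : ι → ℂ) (hω : HasSum (fun i => ‖ω i‖ ^ 2) 1)
    (heig : ∀ i, ContinuousLinearMap.adjoint (A.op i) Ω = (starRingEnd ℂ) (ω i) • Ω) :
    -- the compression is `*`-stable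
    (A.reduced Ω).IsStarStable ∧
    -- the unitary defining the extended characteristic function exists and is unique
    (∃! W : A.DilationSpace ≃ₗᵢ[ℂ] (RowContraction.scalar ω hω).DilationSpace,
      A.IsDilationIntertwiner (RowContraction.scalar ω hω) Ω 1 W) ∧
    ∃ γ : (A.reduced Ω).defectStarSpace →ₗᵢ[ℂ] (RowContraction.scalar ω hω).defectSpace,
      (∀ h : (Submodule.span ℂ {Ω})ᗮ,
        (γ ((A.reduced Ω).defectStarMap h) : HilbertSum ι ℂ) = A.hatDefectStar Ω h) ∧
      ∀ W : A.DilationSpace ≃ₗᵢ[ℂ] (RowContraction.scalar ω hω).DilationSpace,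
        A.IsDilationIntertwiner (RowContraction.scalar ω hω) Ω 1 W →
        -- the extended characteristic function takes its values in `Γ ⊗ 𝒟_ω`
        (∀ f : A.defectSpace, (RowContraction.extendedCharFun W f).fst = 0) ∧
        (∀ h : (Submodule.span ℂ {Ω})ᗮ,
          (RowContraction.scalar ω hω).inclFock
            (HilbertSum.ampliation γ.toContinuousLinearMap ((A.reduced Ω).poissonKernel h)) =
          RowContraction.hatPoisson W (h : H)) ∧
        (∀ (i : ι) (h : (Submodule.span ℂ {Ω})ᗮ),
          (RowContraction.scalar ω hω).inclFock
            (HilbertSum.ampliation γ.toContinuousLinearMap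
              ((A.reduced Ω).charFun ((A.reduced Ω).defectMap (HilbertSum.incl i h)))) =
          RowContraction.extendedCharFun W (A.defectMap (HilbertSum.incl i (h : H)))) := by
  have hex : ∃! W : A.DilationSpace ≃ₗᵢ[ℂ] (RowContraction.scalar ω hω).DilationSpace,
      A.IsDilationIntertwiner (RowContraction.scalar ω hω) Ω 1 W := by
    have h1 := A.isRowEigenvector_inclBase hΩ heig
    have h2 := (RowContraction.scalar ω hω).isRowEigenvector_inclBase (ω := ω) (Ω := 1) (by simp)
      fun i => by rw [RowContraction.adjoint_scalar_op, smul_eq_mul]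
    obtain ⟨W, hW, huniq⟩ := h1.existsUnique_unitary h2
      (RowContraction.orbit_dense_of_isErgodic hcoisom herg hΩ heig)
      (RowContraction.orbit_dense_scalar ω hω)
    exact ⟨W, ⟨hW.1, hW.2⟩, fun U hU => huniq U ⟨hU.intertwines, hU.map_vector⟩⟩
  obtain ⟨γ, hγ⟩ := RowContraction.exists_isometry_defectStarSpace hω hcoisom hΩ heig
  refine ⟨?_, hex, γ, fun h => ?_, fun W hW => ⟨fun f => ?_, fun h => ?_, fun i h => ?_⟩⟩
  · obtain ⟨W, hW, -⟩ := hex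
    refine RowContraction.isStarStable_of_norm_poissonKernel _ fun h => ?_
    -- `1 ⊗ γ` and `W` are isometric, and `(1 ⊗ γ) C̊ h = W h`
    have h1 := congrArg norm (hW.inclFock_poissonKernel hcoisom hΩ hγ h)
    rwa [RowContraction.norm_inclFock, HilbertSum.norm_ampliation, LinearIsometryEquiv.norm_map,
      RowContraction.norm_inclBase] at h1
  · rw [hγ, RowContraction.hatDefectStarMap_coe hω hcoisom heig]
  · refine (hW.fst_eq _).trans ?_
    exact inner_zero_right _
  · exact hW.inclFock_poissonKernel hcoisom hΩ hγ h
  · exact hW.inclFock_charFun hcoisom hΩ heig hγ i h
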